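/- **Setting.** Let $q$ be a prime, $n\ge 2$, $s\in\mathbb F_q^n$, and let $\log$ be the natural logarithm. Let $\sigma>0$ and $t\ge 0$ be real numbers such that $N=t\sigma$ is an integer, and put $D=2t\sigma+1$. For samples $(a_i,c_i)\in\mathbb F_q^n\times\mathbb F_q$, $1\le i\le m$, let $\mathcal F_{\mathrm{LWE}}=\{f(c_i-a_i^{\intercal}x)\}_{1\le i\le m}\subset P=\mathbb F_q[x_1,\dots,x_n]$, where $f(x)=x\prod_{i=1}^{N}(x+i)(x-i)$ has degree $D$. The degree of regularity $d_{\mathrm{reg}}(\mathcal F)$ is the least $d\ge0$ such that the ideal generated by the highest degree components of the elements of $\mathcal F$ contains all homogeneous polynomials of degree $d$. Let $2\le\omega\le 3$ be a linear algebra constant: fix an algorithm (given by arithmetic programs over $\mathbb F_q$ with field operations and zero tests, one for each $q$ and each matrix format) that computes the reduced row echelon form of every $a\times b$ matrix of rank $r$ over every prime field with $O(a\,b\,r^{\omega-2})$ instructions ($r$ being replaced by $1$ for the zero matrix), the implied constant being independent of $q,a,b$. The linear algebra-based Gröbner basis algorithm in degree $d$ repeats the following round, starting from the given system: form the Macaulay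 matrix $M_{\le d}$ of the current system (rows: the products $u\cdot g$ with $g$ in the system, $u$ a monomial and $\deg u+\deg g\le d$; columns: the monomials of degree $\le d$ in descending degree reverse lexicographic (DRL) order), compute its reduced row echelon form, and replace the system by the polynomials given by the nonzero rows. It stops when a round does not change the system, and returns that system. Its time is the sum over all rounds of the number of instructions of the elimination plus the number of coefficients and matrix entries read and written; its memory is the maximal number of field elements stored in a round. **Theorem.** Let $K$ be a constant. 1. *(Complexity.)* Suppose that $m\le K\binom{n+D-1}{D}$ and $d_{\mathrm{reg}}(\mathcal F_{\mathrm{LWE}})=D$. Then the algorithm in degree $2D-1$, applied to $\mathcal F_{\mathrm{LWE}}$, terminates and returns a DRL Gröbner basis of the ideal $(\mathcal F_{\mathrm{LWE}})$. Its time complexity is $$\mathcal O\Big(D^3\cdot 2^{(\omega+3)\cdot 2^{1/\log 2}\cdot(2D-1)^{1/\log 4}\cdot(n-1)^{1-1/\log 4}}\Big)$$ and its memory complexity is $$\mathcal O\Big(D^3\cdot 2^{5\cdot 2^{1/\log 2}\cdot(2D-1)^{1/\log 4}\cdot(n-1)^{1-1/\log 4}}\Big),$$ where the implied constants depend only on $K$,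 $\omega$ and the row reduction algorithm, and not on $q,n,t,\sigma,m$ or the samples. 2. *(Success probability.)* Let $m\le K\binom{n+D-1}{D}$ and let the samples be independent LWE samples $(a_i,\langle s,a_i\rangle+e_i)$, where $a_i\in\mathbb F_q^n$ is uniform and $e_i\in\mathbb Z$ is obtained from a normal random variable with mean $0$ and standard deviation $\sigma$ by a measurable discretization $\delta:\mathbb R\to\mathbb Z$ (such as rounding) with $\delta([-M,M])\subseteq[-M,M]$ for all $M\in\mathbb N$. The algorithm succeeds if all errors satisfy $|e_i|\le t\sigma$ and $s$ is a common zero of the returned polynomials. For fixed $n,\sigma,K$, the probability of success tends to $1$ as $t\to\infty$ (through values with $t\sigma\in\mathbb N$), uniformly in $q,m,s,\delta$; the same holds for the conditional probability of success given $d_{\mathrm{reg}}(\mathcal F_{\mathrm{LWE}})=D$, whenever this event has positive probability. -/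

import Mathlib

open MeasureTheory ProbabilityTheory
open scoped NNReal

/-! ### The degree reverse lexicographic term order -/

/-- Exponent vectors in `n` variables, to be ordered by DRL with `x₁ > x₂ > ⋯ > xₙ`. -/
def DRLExponent (n : ℕ) : Type := Fin n →₀ ℕ

noncomputable instance (n : ℕ) : AddCommMonoid (DRLExponent n) :=
  inferInstanceAs (AddCommMonoid (Fin n →₀ ℕ))

/-- The vector of partial sums `(a₁ + ⋯ + aₙ, a₁ + ⋯ + aₙ₋₁, …, a₁)`; comparing these vectors
lexicographically is DRL, see `drl_lt_iff`. -/
def drlKey {n : ℕ} (a : Fin n →₀ ℕ) : Lex (Fin n → ℕ) :=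
  toLex fun j => ∑ i ∈ Finset.Iic (Fin.rev j), a i

theorem drlKey_add {n : ℕ} (a b : Fin n →₀ ℕ) : drlKey (a + b) = drlKey a + drlKey b := by
  apply ofLex.injective
  funext j
  change ∑ i ∈ Finset.Iic (Fin.rev j), (a + b) i =
    ∑ i ∈ Finset.Iic (Fin.rev j), a i + ∑ i ∈ Finset.Iic (Fin.rev j), b i
  simp [Finset.sum_add_distrib]

theorem sum_Iic_eq_of_drlKey_eq {n : ℕ} {a b : Fin n →₀ ℕ} (h : drlKey a = drlKey b) (i : Fin n) :
    ∑ l ∈ Finset.Iic i, a l = ∑ l ∈ Finset.Iic i, b l := by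
  have := congrFun (congrArg ofLex h) (Fin.rev i)
  simpa [drlKey] using this

theorem drlKey_injective {n : ℕ} : Function.Injective (drlKey (n := n)) := by
  intro a b h
  have h' := sum_Iic_eq_of_drlKey_eq h
  ext i
  induction i using WellFoundedLT.induction with
  | ind i ih =>
    have hi := h' i
    rw [← Finset.Iio_insert, Finset.sum_insert (by simp), Finset.sum_insert (by simp)] at hi
    have : ∑ l ∈ Finset.Iio i, a l = ∑ l ∈ Finset.Iio i, b l :=
      Finset.sum_congr rfl fun l hl => ih l (by simpa using hl)
    omega

noncomputable instance (n : ℕ) : LinearOrder (DRLExponent n) :=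
  LinearOrder.lift' (fun a : DRLExponent n => drlKey (n := n) a) drlKey_injective

theorem DRLExponent.le_def {n : ℕ} (a b : DRLExponent n) :
    a ≤ b ↔ drlKey (n := n) a ≤ drlKey (n := n) b := Iff.rfl

instance (n : ℕ) : IsOrderedAddMonoid (DRLExponent n) where
  add_le_add_left a b h c := by
    rw [DRLExponent.le_def] at h ⊢
    have e₁ : drlKey (n := n) (a + c) = drlKey (n := n) a + drlKey (n := n) c := drlKey_add _ _
    have e₂ : drlKey (n := n) (b + c) = drlKey (n := n) b + drlKey (n := n) c := drlKey_add _ _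
    rw [e₁, e₂]
    exact add_le_add_left h _

instance (n : ℕ) : WellFoundedLT (DRLExponent n) :=
  ⟨InvImage.wf (fun a : DRLExponent n => drlKey (n := n) a) wellFounded_lt⟩

/-- The degree reverse lexicographic term order on `k[x₁, …, xₙ]`. -/
noncomputable def drl (n : ℕ) : MonomialOrder (Fin n) where
  syn := DRLExponent n
  toSyn := { toEquiv := Equiv.refl (Fin n →₀ ℕ), map_add' := fun _ _ => rfl }
  toSyn_monotone a b h := by
    change drlKey a ≤ drlKey b
    exact Pi.toLex_monotone fun j => Finset.sum_le_sum fun i _ => h i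

/-- `x^a < x^b` in DRL iff `deg a < deg b`, or the degrees agree and `aᵢ > bᵢ` at the last
position `i` where `a` and `b` differ. -/
theorem drl_lt_iff {n : ℕ} (a b : Fin n →₀ ℕ) :
    (drl n).toSyn a < (drl n).toSyn b ↔
      a.degree < b.degree ∨
        (a.degree = b.degree ∧ ∃ i, b i < a i ∧ ∀ j, i < j → a j = b j) := by
  have hsum : ∀ (c : Fin n →₀ ℕ) (i : Fin n),
      ∑ l ∈ Finset.Iic i, c l + ∑ l ∈ Finset.Ioi i, c l = c.degree := by
    intro c i
    rw [Finsupp.degree_eq_sum, ← Finset.sum_union (Finset.disjoint_left.2 fun x hx hx' => by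
      simp only [Finset.mem_Iic, Finset.mem_Ioi] at hx hx'; exact absurd hx (not_le.2 hx'))]
    congr 1
    ext x
    simp [le_or_gt]
  have hlt : ∀ a b : Fin n →₀ ℕ, (a.degree < b.degree ∨
      (a.degree = b.degree ∧ ∃ i, b i < a i ∧ ∀ j, i < j → a j = b j)) →
      drlKey a < drlKey b := by
    intro a b h
    have hkey : ∀ i : Fin n, (∀ j, i < j →
          ∑ l ∈ Finset.Iic j, a l = ∑ l ∈ Finset.Iic j, b l) →
        ∑ l ∈ Finset.Iic i, a l < ∑ l ∈ Finset.Iic i, b l → drlKey a < drlKey b := by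
      intro i h₁ h₂
      refine ⟨Fin.rev i, fun j hj => ?_, ?_⟩
      · exact h₁ (Fin.rev j) (by
          have h₃ := Fin.lt_def.1 hj
          rw [Fin.val_rev] at h₃
          rw [Fin.lt_def, Fin.val_rev]
          omega)
      · change ∑ l ∈ Finset.Iic (Fin.rev (Fin.rev i)), a l <
          ∑ l ∈ Finset.Iic (Fin.rev (Fin.rev i)), b l
        simpa using h₂
    rcases h with h | ⟨h, i, hi, hij⟩
    · rcases n with _ | n
      · simp [Finsupp.degree_eq_sum] at h
      · refine hkey (Fin.last n) (fun j hj => absurd hj (not_lt.2 (Fin.le_last j))) ?_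
        have h₁ := hsum a (Fin.last n)
        have h₂ := hsum b (Fin.last n)
        have : Finset.Ioi (Fin.last n) = ∅ := by
          ext x; simp [Fin.le_last]
        simp only [this, Finset.sum_empty, add_zero] at h₁ h₂
        omega
    · have htail : ∀ j, i ≤ j → ∑ l ∈ Finset.Ioi j, a l = ∑ l ∈ Finset.Ioi j, b l := fun j hj =>
        Finset.sum_congr rfl fun l hl => hij l (lt_of_le_of_lt hj (by simpa using hl))
      have hi0 : 0 < i.val := by
        by_contra h0
        have h₁ := hsum a i
        have h₂ := hsum b i
        have : Finset.Iic i = {i} := by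
          ext x
          rw [Finset.mem_Iic, Finset.mem_singleton, Fin.le_def, Fin.ext_iff]
          omega
        simp only [this, Finset.sum_singleton, htail i le_rfl] at h₁ h₂
        omega
      have hi' : Finset.Iic i = insert i (Finset.Iic ⟨i.val - 1, by omega⟩) := by
        ext x
        rw [Finset.mem_insert, Finset.mem_Iic, Finset.mem_Iic, Fin.le_def, Fin.le_def, Fin.ext_iff]
        change x.val ≤ i.val ↔ x.val = i.val ∨ x.val ≤ i.val - 1
        omega
      have hn : i ∉ Finset.Iic (⟨i.val - 1, by omega⟩ : Fin n) := by
        rw [Finset.mem_Iic, Fin.le_def]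
        change ¬ i.val ≤ i.val - 1
        omega
      refine hkey ⟨i.val - 1, by omega⟩ (fun j hj => ?_) ?_
      · have h₁ := hsum a j
        have h₂ := hsum b j
        have h₃ := htail j (by rw [Fin.lt_def] at hj; rw [Fin.le_def]; simp at hj; omega)
        omega
      · have h₁ := hsum a i
        have h₂ := hsum b i
        rw [htail i le_rfl, hi', Finset.sum_insert hn] at h₁
        rw [hi', Finset.sum_insert hn] at h₂
        omega
  constructor
  · intro h
    change drlKey a < drlKey b at h
    by_contra hcon
    push Not at hcon
    obtain ⟨hdeg, hcon⟩ := hcon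
    by_cases hab : a = b
    · exact absurd h (hab ▸ lt_irrefl _)
    refine absurd h (not_lt.2 (hlt b a ?_).le)
    rcases hdeg.lt_or_eq with hd | hd
    · exact Or.inl hd
    refine Or.inr ⟨hd, ?_⟩
    have hne : (Finset.univ.filter fun i => a i ≠ b i).Nonempty := by
      obtain ⟨i, hi⟩ := DFunLike.ne_iff.1 hab
      exact ⟨i, by simpa using hi⟩
    refine ⟨(Finset.univ.filter fun i => a i ≠ b i).max' hne, ?_, ?_⟩
    · have hmem := Finset.max'_mem _ hne
      simp only [Finset.mem_filter, Finset.mem_univ, true_and] at hmem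
      refine lt_of_le_of_ne (not_lt.1 fun hlt' => ?_) hmem
      obtain ⟨j, hj, hj'⟩ := hcon hd.symm _ hlt'
      exact absurd (Finset.le_max' (Finset.univ.filter fun i => a i ≠ b i) j (by simpa using hj'))
        (not_le.2 hj)
    · intro j hj
      by_contra hj'
      exact absurd (Finset.le_max' (Finset.univ.filter fun i => a i ≠ b i) j
        (by simpa using Ne.symm hj')) (not_le.2 hj)
  · exact hlt a b

/-! ### Polynomial systems, degree of regularity, Gröbner bases -/

/-- The highest degree component of a polynomial. -/
noncomputable def topComponent {n : ℕ} {k : Type} [Field k] (f : MvPolynomial (Fin n) k) :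
    MvPolynomial (Fin n) k :=
  MvPolynomial.homogeneousComponent f.totalDegree f

/-- `d_reg(F) = d`: the least degree in which the ideal of the highest degree components of `F`
contains all homogeneous polynomials is (finite and equal to) `d`. -/
def HasDegreeOfRegularity {n : ℕ} {k : Type} [Field k] (F : Set (MvPolynomial (Fin n) k))
    (d : ℕ) : Prop :=
  IsLeast {e : ℕ | ∀ p : MvPolynomial (Fin n) k, p.IsHomogeneous e →
    p ∈ Ideal.span (topComponent '' F)} d

/-- `G` is a Gröbner basis of the ideal `I` with respect to the term order `ord`. -/
def IsGroebnerBasis {n : ℕ} {k : Type} [Field k] (ord : MonomialOrder (Fin n))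
    (G : Set (MvPolynomial (Fin n) k)) (I : Ideal (MvPolynomial (Fin n) k)) : Prop :=
  G.Finite ∧ Ideal.span G = I ∧
    Ideal.span (ord.leadingTerm '' G) =
      Ideal.span (ord.leadingTerm '' (I : Set (MvPolynomial (Fin n) k)))

/-! ### Arithmetic programs over a field

Algebraic computation trees: finite programs over registers holding field elements, with
constants, field operations and zero tests. -/

/-- A program whose outputs are indexed by `o`; `halt out` returns the contents of the
registers `out`. The first argument of an arithmetic instruction is the target register. -/
inductive ArithProg (k o : Type) : Type
  | halt (out : o → ℕ) : ArithProg k o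
  | const (r : ℕ) (c : k) (next : ArithProg k o) : ArithProg k o
  | add (r x y : ℕ) (next : ArithProg k o) : ArithProg k o
  | sub (r x y : ℕ) (next : ArithProg k o) : ArithProg k o
  | mul (r x y : ℕ) (next : ArithProg k o) : ArithProg k o
  | div (r x y : ℕ) (next : ArithProg k o) : ArithProg k o
  | ifZero (x : ℕ) (zero nonzero : ArithProg k o) : ArithProg k o

namespace ArithProg

variable {k o : Type} [Field k] [DecidableEq k]

/-- The output of a program started on the given register contents. -/
def eval : ArithProg k o → (ℕ → k) → o → k
  | halt out, ρ => fun i => ρ (out i)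
  | const r c p, ρ => p.eval (Function.update ρ r c)
  | add r x y p, ρ => p.eval (Function.update ρ r (ρ x + ρ y))
  | sub r x y p, ρ => p.eval (Function.update ρ r (ρ x - ρ y))
  | mul r x y p, ρ => p.eval (Function.update ρ r (ρ x * ρ y))
  | div r x y p, ρ => p.eval (Function.update ρ r (ρ x / ρ y))
  | ifZero x p p', ρ => if ρ x = 0 then p.eval ρ else p'.eval ρ

/-- The number of instructions executed. -/
def steps : ArithProg k o → (ℕ → k) → ℕ
  | halt _, _ => 0
  | const r c p, ρ => p.steps (Function.update ρ r c) + 1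
  | add r x y p, ρ => p.steps (Function.update ρ r (ρ x + ρ y)) + 1
  | sub r x y p, ρ => p.steps (Function.update ρ r (ρ x - ρ y)) + 1
  | mul r x y p, ρ => p.steps (Function.update ρ r (ρ x * ρ y)) + 1
  | div r x y p, ρ => p.steps (Function.update ρ r (ρ x / ρ y)) + 1
  | ifZero x p p', ρ => (if ρ x = 0 then p.steps ρ else p'.steps ρ) + 1

/-- The registers accessed during the execution. -/
def registers [Fintype o] : ArithProg k o → (ℕ → k) → Finset ℕ
  | halt out, _ => Finset.univ.image out
  | const r c p, ρ => {r} ∪ p.registers (Function.update ρ r c)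
  | add r x y p, ρ => {r, x, y} ∪ p.registers (Function.update ρ r (ρ x + ρ y))
  | sub r x y p, ρ => {r, x, y} ∪ p.registers (Function.update ρ r (ρ x - ρ y))
  | mul r x y p, ρ => {r, x, y} ∪ p.registers (Function.update ρ r (ρ x * ρ y))
  | div r x y p, ρ => {r, x, y} ∪ p.registers (Function.update ρ r (ρ x / ρ y))
  | ifZero x p p', ρ => {x} ∪ if ρ x = 0 then p.registers ρ else p'.registers ρ

end ArithProg

/-- Initial register contents for an `a × b` input matrix: the entries in row-major order in
registers `0, …, ab - 1`, and `0` elsewhere. -/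
def loadMatrix {k : Type} [Field k] {a b : ℕ} (A : Matrix (Fin a) (Fin b) k) : ℕ → k :=
  fun r => if h : r < a * b then
    A ⟨r / b, Nat.div_lt_of_lt_mul (by rwa [mul_comm] at h)⟩
      ⟨r % b, Nat.mod_lt _ (Nat.pos_of_ne_zero fun hb => by simp [hb] at h)⟩
  else 0

/-! ### Gaussian elimination and linear algebra exponents -/

/-- An algorithm for Gaussian elimination over prime fields: for every prime `q` and every matrix
format, a program that computes the reduced row echelon form. -/
structure RowReduction where
  prog (q : ℕ) [Fact q.Prime] (a b : ℕ) : ArithProg (ZMod q) (Fin a × Fin b)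
  isReducedRowEchelon (q : ℕ) [Fact q.Prime] (a b : ℕ) (A : Matrix (Fin a) (Fin b) (ZMod q)) :
    (Matrix.of fun i j => (prog q a b).eval (loadMatrix A) (i, j)).IsReducedRowEchelon
  rowSpace_eq (q : ℕ) [Fact q.Prime] (a b : ℕ) (A : Matrix (Fin a) (Fin b) (ZMod q)) :
    Submodule.span (ZMod q)
      (Set.range fun i => fun j => (prog q a b).eval (loadMatrix A) (i, j)) =
    Submodule.span (ZMod q) (Set.range fun i => A i)

namespace RowReduction

variable (E : RowReduction) {q : ℕ} [Fact q.Prime]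

/-- The reduced row echelon form, as computed by `E`. -/
def rref {a b : ℕ} (A : Matrix (Fin a) (Fin b) (ZMod q)) : Matrix (Fin a) (Fin b) (ZMod q) :=
  Matrix.of fun i j => (E.prog q a b).eval (loadMatrix A) (i, j)

/-- The number of instructions `E` executes on `A`. -/
def steps {a b : ℕ} (A : Matrix (Fin a) (Fin b) (ZMod q)) : ℕ :=
  (E.prog q a b).steps (loadMatrix A)

/-- The number of registers `E` occupies on `A`, those of the input matrix included. -/
def space {a b : ℕ} (A : Matrix (Fin a) (Fin b) (ZMod q)) : ℕ :=
  (Finset.range (a * b) ∪ (E.prog q a b).registers (loadMatrix A)).card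

/-- `ω` is a linear algebra constant for `E`: an `a × b` matrix of rank `r` is reduced in
`O(a · b · r^(ω-2))` steps, with one constant for all prime fields. (The rank is replaced by `1`
for the zero matrix.) -/
def HasExponent (E : RowReduction) (ω : ℝ) : Prop :=
  ∃ c : ℝ, ∀ (q : ℕ) [Fact q.Prime] (a b : ℕ) (A : Matrix (Fin a) (Fin b) (ZMod q)),
    (E.steps A : ℝ) ≤ c * a * b * (max A.rank 1 : ℝ) ^ (ω - 2)

end RowReduction

/-! ### The linear algebra-based Gröbner basis algorithm -/

/-- The exponents of the monomials of degree `≤ d` in `n` variables, in descending DRL order. -/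
noncomputable def drlMonomials (n d : ℕ) : List (Fin n →₀ ℕ) :=
  ((((Finset.range (d + 1)).biUnion fun e => Finset.univ.finsuppAntidiag e).map
    (drl n).toSyn.toEquiv.toEmbedding).sort (· ≥ ·)).map (drl n).toSyn.symm

/-- The polynomials `s · f` with `f` in the system `F`, `s` a monomial and `deg(s · f) ≤ d`. -/
noncomputable def macaulayRows {n : ℕ} {k : Type} [Field k] (d : ℕ)
    (F : List (MvPolynomial (Fin n) k)) : List (MvPolynomial (Fin n) k) :=
  F.flatMap fun f => ((drlMonomials n d).filter fun s => s.degree + f.totalDegree ≤ d).map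
    fun s => MvPolynomial.monomial s 1 * f

/-- The Macaulay matrix `M_{≤ d}` of the system `F` with respect to DRL. -/
noncomputable def macaulayMatrix {n : ℕ} {k : Type} [Field k] (d : ℕ)
    (F : List (MvPolynomial (Fin n) k)) :
    Matrix (Fin (macaulayRows d F).length) (Fin (drlMonomials n d).length) k :=
  Matrix.of fun i j => ((macaulayRows d F).get i).coeff ((drlMonomials n d).get j)

namespace RowReduction

variable (E : RowReduction) {q n : ℕ} [Fact q.Prime]

open Classical in
/-- One round: Gaussian elimination on `M_{≤ d}`; the result is the list of the polynomials given
by the nonzero rows, a basis of the row space of `M_{≤ d}`. -/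
noncomputable def round (d : ℕ) (F : List (MvPolynomial (Fin n) (ZMod q))) :
    List (MvPolynomial (Fin n) (ZMod q)) :=
  ((List.finRange (macaulayRows d F).length).map fun i =>
    ∑ j, MvPolynomial.monomial ((drlMonomials n d).get j) (E.rref (macaulayMatrix d F) i j)).filter
      fun g => g ≠ 0

/-- The polynomial system after `j` rounds. -/
noncomputable def system (d : ℕ) (F : List (MvPolynomial (Fin n) (ZMod q))) (j : ℕ) :
    List (MvPolynomial (Fin n) (ZMod q)) :=
  (E.round d)^[j] F

/-- The algorithm stops as soon as a round returns the system it was given. -/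
def Terminates (d : ℕ) (F : List (MvPolynomial (Fin n) (ZMod q))) : Prop :=
  ∃ j, E.system d F (j + 1) = E.system d F j

/-- The index of the last system to which a round is applied. -/
noncomputable def lastRound (d : ℕ) (F : List (MvPolynomial (Fin n) (ZMod q))) : ℕ :=
  sInf {j | E.system d F (j + 1) = E.system d F j}

/-- The output of the algorithm: the stable system, i.e. the rows of the final Macaulay matrix
after elimination. -/
noncomputable def output (d : ℕ) (F : List (MvPolynomial (Fin n) (ZMod q))) :
    List (MvPolynomial (Fin n) (ZMod q)) :=
  E.system d F (E.lastRound d F)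

/-- The time of one round: reading the coefficients of the system, writing the Macaulay matrix,
eliminating, and reading off and comparing the echelon form. -/
noncomputable def roundTime (d : ℕ) (F : List (MvPolynomial (Fin n) (ZMod q))) : ℕ :=
  F.length * (drlMonomials n d).length
    + (macaulayRows d F).length * (drlMonomials n d).length
    + E.steps (macaulayMatrix d F)
    + (macaulayRows d F).length * (drlMonomials n d).length

/-- The number of field elements stored in one round: the system and the registers used by the
elimination of its Macaulay matrix. -/
noncomputable def roundSpace (d : ℕ) (F : List (MvPolynomial (Fin n) (ZMod q))) : ℕ :=
  F.length * (drlMonomials n d).length + E.space (macaulayMatrix d F)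

/-- Total running time. -/
noncomputable def time (d : ℕ) (F : List (MvPolynomial (Fin n) (ZMod q))) : ℕ :=
  ∑ j ∈ Finset.range (E.lastRound d F + 1), E.roundTime d (E.system d F j)

/-- Peak memory. -/
noncomputable def memory (d : ℕ) (F : List (MvPolynomial (Fin n) (ZMod q))) : ℕ :=
  (Finset.range (E.lastRound d F + 1)).sup fun j => E.roundSpace d (E.system d F j)

end RowReduction

/-! ### Learning with errors -/

/-- The error polynomial `x · ∏_{i=1}^{N} (x + i)(x - i)` of degree `2N + 1`. -/
noncomputable def lweErrorPoly (q N : ℕ) [Fact q.Prime] : Polynomial (ZMod q) :=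
  Polynomial.X * ∏ i ∈ Finset.Icc 1 N,
    ((Polynomial.X + Polynomial.C (i : ZMod q)) * (Polynomial.X - Polynomial.C (i : ZMod q)))

/-- The LWE polynomial system `f(cᵢ - aᵢᵀ x)`, `1 ≤ i ≤ m`, of the samples `(aᵢ, cᵢ)`. -/
noncomputable def lweSystem {q n m : ℕ} [Fact q.Prime] (N : ℕ)
    (S : Fin m → (Fin n → ZMod q) × ZMod q) : List (MvPolynomial (Fin n) (ZMod q)) :=
  List.ofFn fun i => Polynomial.aeval
    (MvPolynomial.C (S i).2 - ∑ j, MvPolynomial.C ((S i).1 j) * MvPolynomial.X j)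
    (lweErrorPoly q N)

/-- The LWE sample `(a, ⟨s, a⟩ + e)`. -/
def lweSample {q n : ℕ} (s : Fin n → ZMod q) (w : (Fin n → ZMod q) × ℤ) :
    (Fin n → ZMod q) × ZMod q :=
  (w.1, s ⬝ᵥ w.1 + (w.2 : ZMod q))

/-- The law of the choices `(aᵢ, eᵢ)` behind `m` independent LWE samples: `aᵢ` is uniform and
`eᵢ` has law `χ`. -/
noncomputable def lweChoices (q n m : ℕ) [Fact q.Prime] (χ : Measure ℤ) :
    Measure (Fin m → (Fin n → ZMod q) × ℤ) :=
  Measure.pi fun _ => (uniformOn (Set.univ : Set (Fin n → ZMod q))).prod χ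

/-- A discretization `ℝ → ℤ` of the error (such as rounding to a nearest integer, or truncation):
it maps each interval `[-N, N]`, `N ∈ ℕ`, into itself. -/
def IsDiscretization (δ : ℝ → ℤ) : Prop :=
  Measurable δ ∧ ∀ (x : ℝ) (N : ℕ), |x| ≤ N → |δ x| ≤ N

/-- The error distribution: `N(0, σ)` (`σ` the standard deviation), discretized by `δ`. -/
noncomputable def gaussianError (σ : ℝ≥0) (δ : ℝ → ℤ) : Measure ℤ :=
  (gaussianReal 0 (σ ^ 2)).map δ

/-- The outcomes for which the LWE polynomial system has degree of regularity `D`. -/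
def lweRegular {q n : ℕ} [Fact q.Prime] (m N D : ℕ) (s : Fin n → ZMod q) :
    Set (Fin m → (Fin n → ZMod q) × ℤ) :=
  {w | HasDegreeOfRegularity {f | f ∈ lweSystem N fun i => lweSample s (w i)} D}

/-- The outcomes for which the algorithm, run in degree `d`, succeeds: all errors lie in
`[-N, N]`, and the secret is a zero of the computed basis. -/
def lweSuccess (E : RowReduction) {q n : ℕ} [Fact q.Prime] (m N d : ℕ) (s : Fin n → ZMod q) :
    Set (Fin m → (Fin n → ZMod q) × ℤ) :=
  {w | (∀ i, |(w i).2| ≤ N) ∧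
    ∀ g ∈ E.output d (lweSystem N fun i => lweSample s (w i)), MvPolynomial.eval s g = 0}

/-!
Let `V` be the span of the returned system and `L` the number of monomials of degree at most
`2D - 1`. After the first round the systems are reduced echelon bases of an increasing chain of
spaces of dimension at most `L`, and such a basis is determined by its span, so the system is fixed
after at most `L + 1` rounds. As DRL refines the degree, an element of `V` combines members of the
system of no larger degree; hence `V` contains all its monomial multiples of degree at most
`2D - 1`.

Since the top components generate all forms of degree `D`, every monomial of degree `D` is
congruent modulo `V` to a polynomial of degree less than `D`. This gives a normal form modulo `V`
on the polynomials of degree at most `D`. Multiplication by two variables, followed by reduction,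
stays within degree `D + 1 ≤ 2D - 1` (if `D = 1`, normal forms are constants), so these
multiplications commute modulo `V`: as for border bases, they define a module over the polynomial
ring, and the ideal annihilates the class of `1`. So an element of the ideal of degree less than
`D` lies in `V`, where the reduced basis provides its leading monomial; an element of higher
degree has a leading monomial divisible by one of degree `D`.

For the cost, `L ≤ 2D · 2 ^ (1.15 X)`, where `X` is the exponent in the theorem without its factor
`ω + 3` or `5`. A round costs `O(L ^ (ω + 1))`, so all rounds take time `O(L ^ (ω + 2))`. The spare
factor `2 ^ X` absorbs the constant `1.15` and the power of `D` beyond `D ^ 3`.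

For the success probability, a Chernoff bound makes one error exceed `tσ` with probability
`O(exp (-tσ))`, while for fixed `n` the number of samples is polynomial in `tσ`.
-/

/-! ### Reduced systems of polynomials -/

section ReducedSystem

open MvPolynomial
open scoped MonomialOrder

/-- A list of monic polynomials with strictly decreasing leading monomials, each of which occurs
in no other polynomial of the list: the polynomials that a matrix in reduced row echelon form
encodes when its columns are indexed by monomials in descending order. -/
structure IsReducedSystem {σ k : Type*} [CommSemiring k] (ord : MonomialOrder σ)
    (G : List (MvPolynomial σ k)) : Prop where
  monic : ∀ g ∈ G, ord.Monic g
  pairwise : G.Pairwise fun f g => ord.degree g ≺[ord] ord.degree f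
  coeff_eq_zero : ∀ f ∈ G, ∀ g ∈ G, f ≠ g → g.coeff (ord.degree f) = 0

namespace IsReducedSystem

section CommSemiring

variable {σ k : Type*} [CommSemiring k] {ord : MonomialOrder σ} {G : List (MvPolynomial σ k)}

theorem nodup_map_degree (hG : IsReducedSystem ord G) : (G.map ord.degree).Nodup :=
  List.pairwise_map.2 <| hG.pairwise.imp fun {f g} h e => by simp [e] at h

theorem nodup (hG : IsReducedSystem ord G) : G.Nodup :=
  hG.nodup_map_degree.of_map

theorem eq_of_degree_eq (hG : IsReducedSystem ord G) {f g : MvPolynomial σ k} (hf : f ∈ G)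
    (hg : g ∈ G) (h : ord.degree f = ord.degree g) : f = g :=
  List.inj_on_of_nodup_map hG.nodup_map_degree hf hg h

open Classical in
theorem coeff_degree (hG : IsReducedSystem ord G) {f g : MvPolynomial σ k} (hf : f ∈ G)
    (hg : g ∈ G) : g.coeff (ord.degree f) = if f = g then 1 else 0 := by
  split_ifs with h
  · exact h ▸ (hG.monic f hf).coeff_degree
  · exact hG.coeff_eq_zero f hf g hg h

open Classical in
theorem eq_sum_coeff_smul (hG : IsReducedSystem ord G) {h : MvPolynomial σ k}
    (hh : h ∈ Submodule.span k {g | g ∈ G}) :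
    h = ∑ g ∈ G.toFinset, h.coeff (ord.degree g) • g := by
  induction hh using Submodule.span_induction with
  | mem f hf =>
    have hcoeff : ∀ g ∈ G.toFinset, f.coeff (ord.degree g) • g = if g = f then f else 0 := by
      intro g hg
      rw [hG.coeff_degree (List.mem_toFinset.1 hg) hf]
      split_ifs with h <;> simp [h]
    rw [Finset.sum_congr rfl hcoeff, Finset.sum_ite_eq', if_pos (List.mem_toFinset.2 hf)]
  | zero => simp
  | add x y _ _ hx hy =>
    conv_lhs => rw [hx, hy]
    simp only [coeff_add, add_smul, Finset.sum_add_distrib]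
  | smul a x _ hx =>
    conv_lhs => rw [hx]
    simp only [coeff_smul, Finset.smul_sum, smul_smul, smul_eq_mul]

theorem exists_degree_eq (hG : IsReducedSystem ord G) {h : MvPolynomial σ k}
    (hh : h ∈ Submodule.span k {g | g ∈ G}) (h0 : h ≠ 0) :
    ∃ g ∈ G, ord.degree g = ord.degree h := by
  classical
  have hc : h.coeff (ord.degree h) ≠ 0 := ord.coeff_degree_ne_zero_iff.2 h0
  rw [hG.eq_sum_coeff_smul hh, coeff_sum, ← hG.eq_sum_coeff_smul hh] at hc
  obtain ⟨g, hg, hne⟩ := Finset.exists_ne_zero_of_sum_ne_zero hc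
  rw [coeff_smul, smul_eq_mul] at hne
  exact ⟨g, List.mem_toFinset.1 hg, ord.toSyn.injective <| le_antisymm
    (ord.le_degree (mem_support_iff.2 (left_ne_zero_of_mul hne)))
    (ord.le_degree (mem_support_iff.2 (right_ne_zero_of_mul hne)))⟩

theorem eq_zero_of_coeff_degree (hG : IsReducedSystem ord G) {h : MvPolynomial σ k}
    (hh : h ∈ Submodule.span k {g | g ∈ G}) (h0 : ∀ g ∈ G, h.coeff (ord.degree g) = 0) :
    h = 0 := by
  classical
  rw [hG.eq_sum_coeff_smul hh]
  exact Finset.sum_eq_zero fun g hg => by rw [h0 g (List.mem_toFinset.1 hg), zero_smul]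

end CommSemiring

variable {σ k : Type*} [CommRing k] [Nontrivial k] {ord : MonomialOrder σ}
  {G G' : List (MvPolynomial σ k)}

theorem mem_of_span_eq (hG : IsReducedSystem ord G) (hG' : IsReducedSystem ord G')
    (h : Submodule.span k {g | g ∈ G} = Submodule.span k {g | g ∈ G'})
    {g : MvPolynomial σ k} (hg : g ∈ G) : g ∈ G' := by
  classical
  have hgG' : g ∈ Submodule.span k {g | g ∈ G'} := h ▸ Submodule.subset_span hg
  obtain ⟨g', hg', hdeg⟩ := hG'.exists_degree_eq hgG' (hG.monic g hg).ne_zero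
  have hcoeff : ∀ f ∈ G', (g - g').coeff (ord.degree f) = 0 := by
    intro f hf
    have hfG : f ∈ Submodule.span k {g | g ∈ G} := h ▸ Submodule.subset_span hf
    obtain ⟨f', hf', hdeg'⟩ := hG.exists_degree_eq hfG (hG'.monic f hf).ne_zero
    have hiff : f' = g ↔ f = g' :=
      ⟨fun e => hG'.eq_of_degree_eq hf hg' (by rw [← hdeg', e, hdeg]),
        fun e => hG.eq_of_degree_eq hf' hg (by rw [hdeg', e, hdeg])⟩
    rw [coeff_sub, hG'.coeff_degree hf hg', ← hdeg', hG.coeff_degree hf' hg]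
    simp only [hiff, sub_self]
  have hsub := hG'.eq_zero_of_coeff_degree
    (Submodule.sub_mem _ hgG' (Submodule.subset_span hg')) hcoeff
  rwa [sub_eq_zero.1 hsub]

theorem eq_of_span_eq (hG : IsReducedSystem ord G) (hG' : IsReducedSystem ord G')
    (h : Submodule.span k {g | g ∈ G} = Submodule.span k {g | g ∈ G'}) : G = G' :=
  List.Perm.eq_of_pairwise (fun _ _ _ _ h₁ h₂ => absurd (h₁.trans h₂) (lt_irrefl _))
    hG.pairwise hG'.pairwise
    ((List.perm_ext_iff_of_nodup hG.nodup hG'.nodup).2 fun _ =>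
      ⟨hG.mem_of_span_eq hG' h, hG'.mem_of_span_eq hG h.symm⟩)

end IsReducedSystem

end ReducedSystem

/-! ### The monomials of bounded degree -/

section BoundedDegree

open MvPolynomial
open scoped MonomialOrder

theorem degree_le_of_drl_le {n : ℕ} {a b : Fin n →₀ ℕ} (h : a ≼[drl n] b) :
    a.degree ≤ b.degree := by
  by_contra! hlt
  exact absurd ((drl_lt_iff b a).2 (Or.inl hlt)) h.not_gt

theorem degree_le_totalDegree {σ k : Type*} [CommSemiring k] {f : MvPolynomial σ k} {a : σ →₀ ℕ}
    (ha : f.coeff a ≠ 0) : a.degree ≤ f.totalDegree :=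
  le_totalDegree (mem_support_iff.2 ha)

theorem totalDegree_le_of_coeff {σ k : Type*} [CommSemiring k] {f : MvPolynomial σ k} {d : ℕ}
    (h : ∀ a, f.coeff a ≠ 0 → a.degree ≤ d) : f.totalDegree ≤ d :=
  Finset.sup_le fun a ha => h a (mem_support_iff.1 ha)

theorem totalDegree_eq_degree_drl_degree {n : ℕ} {k : Type*} [CommSemiring k]
    (f : MvPolynomial (Fin n) k) : f.totalDegree = ((drl n).degree f).degree := by
  by_cases hf : f = 0
  · simp [hf]
  · exact le_antisymm
      (totalDegree_le_of_coeff fun a ha =>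
        degree_le_of_drl_le ((drl n).le_degree (mem_support_iff.2 ha)))
      (degree_le_totalDegree ((drl n).coeff_degree_ne_zero_iff.2 hf))

theorem mem_drlMonomials {n d : ℕ} {a : Fin n →₀ ℕ} : a ∈ drlMonomials n d ↔ a.degree ≤ d := by
  simp only [drlMonomials, List.mem_map, Finset.mem_sort, Finset.mem_map, Finset.mem_biUnion,
    Finset.mem_range, Finset.mem_finsuppAntidiag, Finsupp.degree_eq_sum]
  constructor
  · rintro ⟨_, ⟨b, ⟨e, he, hb, -⟩, rfl⟩, rfl⟩
    have hb' : (drl n).toSyn.symm ((drl n).toSyn.toEquiv.toEmbedding b) = b :=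
      (drl n).toSyn.symm_apply_apply b
    rw [hb', hb]
    exact Nat.lt_succ_iff.1 he
  · intro h
    exact ⟨_, ⟨a, ⟨_, Nat.lt_succ_iff.2 h, rfl, Finset.subset_univ _⟩, rfl⟩,
      (drl n).toSyn.symm_apply_apply a⟩

theorem length_drlMonomials (n d : ℕ) : (drlMonomials n d).length = (d + n).choose n := by
  rw [drlMonomials, List.length_map, Finset.length_sort, Finset.card_map, Finset.card_biUnion]
  · simp_rw [Finset.card_finsuppAntidiag_nat_eq_multichoose, Finset.card_univ, Fintype.card_fin]
    exact Nat.sum_range_multichoose d n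
  · intro x _ y _ hxy
    refine Finset.disjoint_left.2 fun a ha ha' => hxy ?_
    exact (Finset.mem_finsuppAntidiag.1 ha).1.symm.trans (Finset.mem_finsuppAntidiag.1 ha').1

theorem one_le_length_drlMonomials (n d : ℕ) : 1 ≤ (drlMonomials n d).length :=
  length_drlMonomials n d ▸ Nat.choose_pos (Nat.le_add_left n d)

theorem drlMonomials_strictAnti (n d : ℕ) :
    StrictAnti fun i => (drl n).toSyn ((drlMonomials n d).get i) := by
  have hpairwise : (drlMonomials n d).Pairwise fun a b => b ≺[drl n] a := by
    rw [drlMonomials, List.pairwise_map]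
    refine ((Finset.pairwise_sort _ _).and (Finset.sort_nodup _ _)).imp fun {a b} h => ?_
    rw [AddEquiv.apply_symm_apply, AddEquiv.apply_symm_apply]
    exact lt_of_le_of_ne h.1 h.2.symm
  exact fun i j hij => List.pairwise_iff_get.1 hpairwise i j hij

theorem drlMonomials_get_injective (n d : ℕ) : Function.Injective (drlMonomials n d).get :=
  Function.Injective.of_comp (f := (drl n).toSyn) (drlMonomials_strictAnti n d).injective

theorem IsReducedSystem.length_le {n d : ℕ} {k : Type*} [CommSemiring k]
    {G : List (MvPolynomial (Fin n) k)} (hG : IsReducedSystem (drl n) G)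
    (hd : ∀ g ∈ G, g.totalDegree ≤ d) : G.length ≤ (drlMonomials n d).length := by
  rw [← List.length_map (f := (drl n).degree) (as := G)]
  refine (List.subperm_of_subset hG.nodup_map_degree fun a ha => ?_).length_le
  obtain ⟨g, hg, rfl⟩ := List.mem_map.1 ha
  exact mem_drlMonomials.2 (totalDegree_eq_degree_drl_degree g ▸ hd g hg)

end BoundedDegree

/-! ### Rows of Macaulay matrices as polynomials -/

section MacaulayRows

open MvPolynomial
open scoped MonomialOrder

section CommSemiring

variable {n d : ℕ} {k : Type*} [CommSemiring k]

/-- The polynomial of degree at most `d` with a given row of coefficients, the columns being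
indexed by `drlMonomials n d` as in `macaulayMatrix`. -/
noncomputable def polyOfRow (n d : ℕ) (k : Type*) [CommSemiring k] :
    (Fin (drlMonomials n d).length → k) →ₗ[k] MvPolynomial (Fin n) k :=
  ∑ j, monomial ((drlMonomials n d).get j) ∘ₗ LinearMap.proj j

theorem polyOfRow_apply (v : Fin (drlMonomials n d).length → k) :
    polyOfRow n d k v = ∑ j, monomial ((drlMonomials n d).get j) (v j) := by
  simp [polyOfRow, LinearMap.sum_apply]

theorem coeff_polyOfRow (v : Fin (drlMonomials n d).length → k)
    (j : Fin (drlMonomials n d).length) :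
    (polyOfRow n d k v).coeff ((drlMonomials n d).get j) = v j := by
  classical
  rw [polyOfRow_apply, coeff_sum, Finset.sum_eq_single j]
  · simp
  · intro i _ hij
    rw [coeff_monomial, if_neg ((drlMonomials_get_injective n d).ne hij)]
  · simp

theorem coeff_polyOfRow_of_lt_degree (v : Fin (drlMonomials n d).length → k) {a : Fin n →₀ ℕ}
    (ha : d < a.degree) : (polyOfRow n d k v).coeff a = 0 := by
  classical
  rw [polyOfRow_apply, coeff_sum]
  refine Finset.sum_eq_zero fun j _ => ?_
  rw [coeff_monomial, if_neg]
  rintro rfl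
  exact ha.not_ge (mem_drlMonomials.1 (List.get_mem _ j))

theorem totalDegree_polyOfRow_le (v : Fin (drlMonomials n d).length → k) :
    (polyOfRow n d k v).totalDegree ≤ d :=
  totalDegree_le_of_coeff fun _ ha =>
    not_lt.1 fun hlt => ha (coeff_polyOfRow_of_lt_degree v hlt)

theorem polyOfRow_coeff {f : MvPolynomial (Fin n) k} (hf : f.totalDegree ≤ d) :
    polyOfRow n d k (fun j => f.coeff ((drlMonomials n d).get j)) = f := by
  ext a
  rcases le_or_gt a.degree d with ha | ha
  · obtain ⟨j, rfl⟩ := List.mem_iff_get.1 (mem_drlMonomials.2 ha)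
    rw [coeff_polyOfRow]
  · rw [coeff_polyOfRow_of_lt_degree _ ha]
    by_contra h
    exact ha.not_ge ((degree_le_totalDegree (Ne.symm h)).trans hf)

theorem totalDegree_monomial_mul_le {σ : Type*} (s : σ →₀ ℕ) (f : MvPolynomial σ k) :
    (monomial s (1 : k) * f).totalDegree ≤ s.degree + f.totalDegree :=
  (totalDegree_mul _ _).trans (Nat.add_le_add_right (totalDegree_monomial_le _ _) _)

theorem degree_polyOfRow_of_isLeadingEntry {ι : Type*}
    {A : Matrix ι (Fin (drlMonomials n d).length) k} {i : ι}
    {c : Fin (drlMonomials n d).length} (h : A.IsLeadingEntry i c) :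
    (drl n).degree (polyOfRow n d k (A i)) = (drlMonomials n d).get c := by
  refine (drl n).toSyn.injective (le_antisymm (MonomialOrder.degree_le_iff.2 fun a ha => ?_)
    ((drl n).le_degree (mem_support_iff.2 (by rw [coeff_polyOfRow]; exact h.2))))
  have had : a.degree ≤ d :=
    (degree_le_totalDegree (mem_support_iff.1 ha)).trans (totalDegree_polyOfRow_le _)
  obtain ⟨j, rfl⟩ := List.mem_iff_get.1 (mem_drlMonomials.2 had)
  rw [mem_support_iff, coeff_polyOfRow] at ha
  exact (drlMonomials_strictAnti n d).antitone (not_lt.1 fun hj => ha (h.1 j hj))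

theorem isReducedSystem_of_isReducedRowEchelon {a : ℕ}
    [DecidablePred fun g : MvPolynomial (Fin n) k => g ≠ 0]
    {A : Matrix (Fin a) (Fin (drlMonomials n d).length) k} (hA : A.IsReducedRowEchelon) :
    IsReducedSystem (drl n)
      (((List.finRange a).map fun i => polyOfRow n d k (A i)).filter fun g => g ≠ 0) := by
  have hlead : ∀ i, polyOfRow n d k (A i) ≠ 0 → ∃ c, A.IsLeadingEntry i c := fun i hi =>
    Matrix.row_ne_zero_iff_exists_isLeadingEntry.1 fun h => hi (by rw [h, map_zero])
  have hmem : ∀ g ∈ ((List.finRange a).map fun i => polyOfRow n d k (A i)).filter fun g => g ≠ 0,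
      ∃ i c, A.IsLeadingEntry i c ∧ g = polyOfRow n d k (A i) := by
    intro g hg
    simp only [List.mem_filter, List.mem_map, List.mem_finRange, true_and, ne_eq,
      decide_eq_true_eq] at hg
    obtain ⟨⟨i, rfl⟩, h0⟩ := hg
    exact ⟨i, (hlead i h0).choose, (hlead i h0).choose_spec, rfl⟩
  refine ⟨fun g hg => ?_, ?_, fun f hf g hg hne => ?_⟩
  · obtain ⟨i, c, hc, rfl⟩ := hmem g hg
    rw [MonomialOrder.Monic, MonomialOrder.leadingCoeff, degree_polyOfRow_of_isLeadingEntry hc,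
      coeff_polyOfRow]
    exact hA.eq_one hc
  · rw [List.pairwise_filter, List.pairwise_map]
    refine (List.pairwise_lt_finRange a).imp fun {i₁ i₂} hlt h₁ h₂ => ?_
    obtain ⟨c₁, hc₁⟩ := hlead i₁ (of_decide_eq_true h₁)
    obtain ⟨c₂, hc₂⟩ := hlead i₂ (of_decide_eq_true h₂)
    rw [degree_polyOfRow_of_isLeadingEntry hc₁, degree_polyOfRow_of_isLeadingEntry hc₂]
    refine drlMonomials_strictAnti n d (not_le.1 fun hle => hc₂.2 ?_)
    exact hA.isRowEchelon hlt fun j hj => hc₁.1 j (hj.trans_le hle)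
  · obtain ⟨i, c, hc, rfl⟩ := hmem f hf
    obtain ⟨i', _, _, rfl⟩ := hmem g hg
    rw [degree_polyOfRow_of_isLeadingEntry hc, coeff_polyOfRow]
    exact hA.eq_zero_of_ne_of_isLeadingEntry (fun e => hne (by rw [e])) hc

end CommSemiring

variable {n d : ℕ} {k : Type} [Field k] {F : List (MvPolynomial (Fin n) k)}

theorem mem_macaulayRows {p : MvPolynomial (Fin n) k} :
    p ∈ macaulayRows d F ↔
      ∃ f ∈ F, ∃ s : Fin n →₀ ℕ, s.degree + f.totalDegree ≤ d ∧ monomial s 1 * f = p := by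
  simp only [macaulayRows, List.mem_flatMap, List.mem_map, List.mem_filter, mem_drlMonomials,
    decide_eq_true_eq]
  exact ⟨fun ⟨f, hf, s, ⟨_, h⟩, hp⟩ => ⟨f, hf, s, h, hp⟩,
    fun ⟨f, hf, s, h, hp⟩ => ⟨f, hf, s, ⟨le_of_add_le_left h, h⟩, hp⟩⟩

theorem polyOfRow_macaulayMatrix (i : Fin (macaulayRows d F).length) :
    polyOfRow n d k (macaulayMatrix d F i) = (macaulayRows d F).get i := by
  obtain ⟨f, _, s, hs, hp⟩ := mem_macaulayRows.1 (List.get_mem (macaulayRows d F) i)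
  exact polyOfRow_coeff (hp ▸ (totalDegree_monomial_mul_le s f).trans hs)

theorem length_macaulayRows_le (d : ℕ) (F : List (MvPolynomial (Fin n) k)) :
    (macaulayRows d F).length ≤ F.length * (drlMonomials n d).length := by
  rw [macaulayRows, List.length_flatMap]
  refine (List.sum_le_card_nsmul _ (drlMonomials n d).length fun x hx => ?_).trans (by simp)
  obtain ⟨f, _, rfl⟩ := List.mem_map.1 hx
  rw [List.length_map]
  exact List.length_filter_le _ _

end MacaulayRows

/-! ### The rounds of the algorithm -/

/-- A space of polynomials that contains all monomial multiples of degree at most `d` of each of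
its elements. -/
def IsMulClosedUpTo {σ k : Type*} [CommSemiring k] (d : ℕ)
    (V : Submodule k (MvPolynomial σ k)) : Prop :=
  ∀ h ∈ V, ∀ s : σ →₀ ℕ, s.degree + h.totalDegree ≤ d → MvPolynomial.monomial s 1 * h ∈ V

namespace RowReduction

open MvPolynomial

variable (E : RowReduction) {q n d : ℕ} [Fact q.Prime]

open Classical in
theorem round_eq (d : ℕ) (F : List (MvPolynomial (Fin n) (ZMod q))) :
    E.round d F = ((List.finRange (macaulayRows d F).length).map fun i =>
      polyOfRow n d (ZMod q) (E.rref (macaulayMatrix d F) i)).filter fun g => g ≠ 0 := by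
  simp only [round, polyOfRow_apply]

theorem isReducedSystem_round (d : ℕ) (F : List (MvPolynomial (Fin n) (ZMod q))) :
    IsReducedSystem (drl n) (E.round d F) :=
  E.round_eq d F ▸ isReducedSystem_of_isReducedRowEchelon (E.isReducedRowEchelon q _ _ _)

theorem totalDegree_le_of_mem_round {F : List (MvPolynomial (Fin n) (ZMod q))}
    {g : MvPolynomial (Fin n) (ZMod q)} (hg : g ∈ E.round d F) : g.totalDegree ≤ d := by
  rw [round_eq] at hg
  obtain ⟨i, _, rfl⟩ := List.mem_map.1 (List.mem_filter.1 hg).1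
  exact totalDegree_polyOfRow_le _

theorem span_round (d : ℕ) (F : List (MvPolynomial (Fin n) (ZMod q))) :
    Submodule.span (ZMod q) {g | g ∈ E.round d F} =
      Submodule.span (ZMod q) {g | g ∈ macaulayRows d F} := by
  have hround : {g | g ∈ E.round d F} = Set.range (fun i =>
      polyOfRow n d (ZMod q) (E.rref (macaulayMatrix d F) i)) \ {0} := by
    ext g
    simp [round_eq]
  have hrows : {g | g ∈ macaulayRows d F} = Set.range fun i =>
      polyOfRow n d (ZMod q) (macaulayMatrix d F i) := by
    ext g
    simp only [polyOfRow_macaulayMatrix]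
    exact List.mem_iff_get
  have hmap : ∀ A : Matrix (Fin (macaulayRows d F).length) (Fin (drlMonomials n d).length) (ZMod q),
      Submodule.span (ZMod q) (Set.range fun i => polyOfRow n d (ZMod q) (A i)) =
        (Submodule.span (ZMod q) (Set.range fun i => A i)).map (polyOfRow n d (ZMod q)) := by
    intro A
    rw [Submodule.map_span, ← Set.range_comp]
    rfl
  rw [hround, Submodule.span_sdiff_singleton_zero, hrows, hmap, hmap]
  exact congrArg _ (E.rowSpace_eq q _ _ (macaulayMatrix d F))

theorem span_le_span_round {F : List (MvPolynomial (Fin n) (ZMod q))}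
    (hF : ∀ f ∈ F, f.totalDegree ≤ d) :
    Submodule.span (ZMod q) {g | g ∈ F} ≤ Submodule.span (ZMod q) {g | g ∈ E.round d F} := by
  rw [span_round]
  refine Submodule.span_mono fun f hf => mem_macaulayRows.2 ⟨f, hf, 0, by simpa using hF f hf, ?_⟩
  rw [monomial_zero', C_1, one_mul]

theorem mem_ideal_of_mem_round {F : List (MvPolynomial (Fin n) (ZMod q))}
    {I : Ideal (MvPolynomial (Fin n) (ZMod q))} (hF : ∀ f ∈ F, f ∈ I) :
    ∀ g ∈ E.round d F, g ∈ I := by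
  suffices Submodule.span (ZMod q) {g | g ∈ E.round d F} ≤ I.restrictScalars (ZMod q) from
    fun g hg => this (Submodule.subset_span hg)
  rw [span_round, Submodule.span_le]
  intro p hp
  obtain ⟨f, hf, s, _, rfl⟩ := mem_macaulayRows.1 hp
  exact I.mul_mem_left _ (hF f hf)

section System

variable {F : List (MvPolynomial (Fin n) (ZMod q))}

theorem system_succ (d : ℕ) (F : List (MvPolynomial (Fin n) (ZMod q))) (j : ℕ) :
    E.system d F (j + 1) = E.round d (E.system d F j) :=
  Function.iterate_succ_apply' _ _ _

theorem isReducedSystem_system_succ (d : ℕ) (F : List (MvPolynomial (Fin n) (ZMod q))) (j : ℕ) :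
    IsReducedSystem (drl n) (E.system d F (j + 1)) :=
  E.system_succ d F j ▸ E.isReducedSystem_round d _

theorem totalDegree_le_of_mem_system_succ (j : ℕ) :
    ∀ f ∈ E.system d F (j + 1), f.totalDegree ≤ d := by
  rw [system_succ]
  exact fun f hf => E.totalDegree_le_of_mem_round hf

theorem length_system_succ_le (d : ℕ) (F : List (MvPolynomial (Fin n) (ZMod q))) (j : ℕ) :
    (E.system d F (j + 1)).length ≤ (drlMonomials n d).length :=
  (E.isReducedSystem_system_succ d F j).length_le (E.totalDegree_le_of_mem_system_succ j)

theorem length_system_le (d : ℕ) (F : List (MvPolynomial (Fin n) (ZMod q))) :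
    ∀ j, (E.system d F j).length ≤ max F.length (drlMonomials n d).length
  | 0 => le_max_left _ _
  | j + 1 => le_max_of_le_right (E.length_system_succ_le d F j)

theorem mem_ideal_of_mem_system {I : Ideal (MvPolynomial (Fin n) (ZMod q))}
    (hF : ∀ f ∈ F, f ∈ I) (j : ℕ) : ∀ g ∈ E.system d F j, g ∈ I := by
  induction j with
  | zero => exact hF
  | succ j ih => exact E.system_succ d F j ▸ E.mem_ideal_of_mem_round ih

theorem span_system_succ_mono (d : ℕ) (F : List (MvPolynomial (Fin n) (ZMod q))) :
    Monotone fun j => Submodule.span (ZMod q) {g | g ∈ E.system d F (j + 1)} := by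
  refine monotone_nat_of_le_succ fun j => ?_
  rw [E.system_succ d F (j + 1)]
  exact E.span_le_span_round (E.totalDegree_le_of_mem_system_succ j)

theorem finrank_span_system_succ_le (d : ℕ) (F : List (MvPolynomial (Fin n) (ZMod q))) (j : ℕ) :
    Module.finrank (ZMod q) (Submodule.span (ZMod q) {g | g ∈ E.system d F (j + 1)}) ≤
      (drlMonomials n d).length := by
  classical
  rw [← List.coe_toFinset]
  exact (finrank_span_finset_le_card _).trans
    ((List.toFinset_card_le _).trans (E.length_system_succ_le d F j))

/- After the first round all systems are reduced, hence determined by the spaces they span; these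
spaces increase, and their dimensions are bounded by the number of monomials. -/
theorem system_length_drlMonomials_add_two :
    E.system d F ((drlMonomials n d).length + 2) =
      E.system d F ((drlMonomials n d).length + 1) := by
  let V := fun j => Submodule.span (ZMod q) {g | g ∈ E.system d F (j + 1)}
  have hfin : ∀ j, FiniteDimensional (ZMod q) (V j) := fun j =>
    FiniteDimensional.span_of_finite _ (List.finite_toSet _)
  have hmono : Monotone fun j => Module.finrank (ZMod q) (V j) := fun i j hij =>
    have := hfin j
    Submodule.finrank_mono (E.span_system_succ_mono d F hij)
  have heq : ∀ j, Module.finrank (ZMod q) (V j) = Module.finrank (ZMod q) (V (j + 1)) →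
      E.system d F (j + 1) = E.system d F (j + 2) := fun j h =>
    have := hfin (j + 1)
    (E.isReducedSystem_system_succ d F j).eq_of_span_eq (E.isReducedSystem_system_succ d F (j + 1))
      (Submodule.eq_of_le_of_finrank_eq (E.span_system_succ_mono d F j.le_succ) h)
  have hnext : ∀ j, E.system d F (j + 1) = E.system d F (j + 2) →
      E.system d F (j + 2) = E.system d F (j + 3) := fun j h => by
    rw [E.system_succ d F (j + 2), ← h, ← system_succ, h]
  have hVnext : ∀ j, Module.finrank (ZMod q) (V j) = Module.finrank (ZMod q) (V (j + 1)) →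
      Module.finrank (ZMod q) (V (j + 1)) = Module.finrank (ZMod q) (V (j + 2)) := fun j h => by
    change _ = Module.finrank (ZMod q) (Submodule.span (ZMod q) {g | g ∈ E.system d F (j + 3)})
    rw [← hnext j (heq j h)]
  have hstable := Nat.stabilises_of_monotone hmono (E.finrank_span_system_succ_le d F) hVnext
    (Nat.le_succ (drlMonomials n d).length)
  exact (heq _ hstable.symm).symm

theorem terminates (d : ℕ) (F : List (MvPolynomial (Fin n) (ZMod q))) : E.Terminates d F :=
  ⟨_, E.system_length_drlMonomials_add_two⟩

theorem lastRound_le (d : ℕ) (F : List (MvPolynomial (Fin n) (ZMod q))) :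
    E.lastRound d F ≤ (drlMonomials n d).length + 1 :=
  Nat.sInf_le E.system_length_drlMonomials_add_two

theorem round_output (d : ℕ) (F : List (MvPolynomial (Fin n) (ZMod q))) :
    E.round d (E.output d F) = E.output d F := by
  rw [output, ← system_succ]
  exact Nat.sInf_mem (E.terminates d F)

theorem isReducedSystem_output (d : ℕ) (F : List (MvPolynomial (Fin n) (ZMod q))) :
    IsReducedSystem (drl n) (E.output d F) := by
  rw [← E.round_output d F]
  exact E.isReducedSystem_round d _

theorem span_le_span_output (hF : ∀ f ∈ F, f.totalDegree ≤ d) :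
    Submodule.span (ZMod q) {g | g ∈ F} ≤ Submodule.span (ZMod q) {g | g ∈ E.output d F} := by
  rw [output]
  cases E.lastRound d F with
  | zero => exact le_rfl
  | succ j =>
    refine le_trans ?_ (E.span_system_succ_mono d F j.zero_le)
    beta_reduce
    rw [system_succ]
    exact E.span_le_span_round hF

theorem isMulClosedUpTo_span_output (d : ℕ) (F : List (MvPolynomial (Fin n) (ZMod q))) :
    IsMulClosedUpTo d (Submodule.span (ZMod q) {g | g ∈ E.output d F}) := by
  classical
  intro h hh s hs
  rw [(E.isReducedSystem_output d F).eq_sum_coeff_smul hh, Finset.mul_sum]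
  refine Submodule.sum_mem _ fun g hg => ?_
  rw [mul_smul_comm]
  by_cases h0 : h.coeff ((drl n).degree g) = 0
  · simp [h0]
  have hdeg : g.totalDegree ≤ h.totalDegree := by
    rw [totalDegree_eq_degree_drl_degree g]
    exact degree_le_totalDegree h0
  have hrow : monomial s 1 * g ∈ macaulayRows d (E.output d F) :=
    mem_macaulayRows.2 ⟨g, by simpa using hg, s, (Nat.add_le_add_left hdeg _).trans hs, rfl⟩
  have hspan := E.span_round d (E.output d F)
  rw [round_output] at hspan
  rw [hspan]
  exact Submodule.smul_mem _ _ (Submodule.subset_span hrow)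

end System

end RowReduction

/-! ### Normal forms modulo a space of polynomials -/

section NormalForm

open MvPolynomial

open scoped IsMulCommutative in
theorem exists_algHom_X_eq_of_commute {σ k A : Type*} [CommSemiring k] [Semiring A] [Algebra k A]
    (M : σ → A) (hM : ∀ i j, M i * M j = M j * M i) :
    ∃ φ : MvPolynomial σ k →ₐ[k] A, ∀ i, φ (X i) = M i := by
  have := Algebra.isMulCommutative_adjoin k (s := Set.range M) <| by
    rintro _ ⟨i, rfl⟩ _ ⟨j, rfl⟩
    exact hM i j
  let ψ : MvPolynomial σ k →ₐ[k] Algebra.adjoin k (Set.range M) :=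
    aeval fun i => ⟨M i, Algebra.subset_adjoin ⟨i, rfl⟩⟩
  exact ⟨(Algebra.adjoin k (Set.range M)).val.comp ψ, fun i => by simp [ψ]⟩

theorem mem_span_monomial_of_totalDegree_le {σ k : Type*} [CommSemiring k] {d : ℕ}
    {p : MvPolynomial σ k} (hp : p.totalDegree ≤ d) :
    p ∈ Submodule.span k ((monomial · (1 : k)) '' {u : σ →₀ ℕ | u.degree ≤ d}) := by
  rw [← mem_restrictTotalDegree, restrictTotalDegree, restrictSupport_eq_span] at hp
  exact hp

variable {σ k : Type*} [CommRing k] {V : Submodule k (MvPolynomial σ k)} {d e : ℕ}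

theorem IsMulClosedUpTo.X_mul_mem (hV : IsMulClosedUpTo d V) {p : MvPolynomial σ k} (hp : p ∈ V)
    (hd : p.totalDegree + 1 ≤ d) (i : σ) : X i * p ∈ V :=
  hV p hp (Finsupp.single i 1) (by rwa [Finsupp.degree_single, add_comm])

theorem totalDegree_X_mul_le (i : σ) (p : MvPolynomial σ k) :
    (X i * p).totalDegree ≤ p.totalDegree + 1 :=
  (totalDegree_monomial_mul_le (Finsupp.single i 1) p).trans
    (by rw [Finsupp.degree_single, add_comm])

/-- `N` is a linear projection onto the polynomials of degree at most `e` that reduces the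
polynomials of degree at most `e + 1` modulo `V`. -/
structure IsNormalForm (V : Submodule k (MvPolynomial σ k)) (e : ℕ)
    (N : MvPolynomial σ k →ₗ[k] MvPolynomial σ k) : Prop where
  totalDegree_le : ∀ p, (N p).totalDegree ≤ e
  apply_eq_self : ∀ p, p.totalDegree ≤ e → N p = p
  sub_mem : ∀ p, p.totalDegree ≤ e + 1 → p - N p ∈ V

theorem exists_isNormalForm
    (h : ∀ u : σ →₀ ℕ, u.degree = e + 1 → ∃ g ∈ V, (g - monomial u 1).totalDegree ≤ e) :
    ∃ N, IsNormalForm V e N := by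
  choose! g hgV hg using h
  let b : (σ →₀ ℕ) → MvPolynomial σ k := fun u =>
    if u.degree ≤ e then monomial u 1 else if u.degree = e + 1 then monomial u 1 - g u else 0
  let N := (basisMonomials σ k).constr k b
  have hN : ∀ u, N (monomial u 1) = b u := fun u => by
    rw [← (basisMonomials σ k).constr_basis k b u, coe_basisMonomials]
  have hb : ∀ u, (b u).totalDegree ≤ e := by
    intro u
    dsimp only [b]
    split_ifs with h₁ h₂
    · exact (totalDegree_monomial_le u 1).trans h₁
    · rw [← totalDegree_neg, neg_sub]
      exact hg u h₂
    · simp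
  refine ⟨N, fun p => ?_, fun p hp => ?_, fun p hp => ?_⟩
  · have hrange : LinearMap.range N ≤ restrictTotalDegree σ k e := by
      rw [Module.Basis.constr_range, Submodule.span_le]
      rintro _ ⟨u, rfl⟩
      exact (mem_restrictTotalDegree _ _ _).2 (hb u)
    exact (mem_restrictTotalDegree _ _ _).1 (hrange ⟨p, rfl⟩)
  · refine LinearMap.eqOn_span (g := LinearMap.id) ?_ (mem_span_monomial_of_totalDegree_le hp)
    rintro _ ⟨u, hu, rfl⟩
    exact (hN u).trans (if_pos hu)
  · suffices hle : Submodule.span k ((monomial · (1 : k)) '' {u : σ →₀ ℕ | u.degree ≤ e + 1}) ≤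
        V.comap (LinearMap.id - N) from hle (mem_span_monomial_of_totalDegree_le hp)
    rw [Submodule.span_le]
    rintro _ ⟨u, hu, rfl⟩
    change monomial u 1 - N (monomial u 1) ∈ V
    rw [hN]
    rcases Nat.le_succ_iff.1 (show u.degree ≤ e + 1 from hu) with hu | hu
    · simp [b, hu]
    · simpa [b, hu] using hgV u hu

/-- Multiplication by `X i` on normal forms. -/
noncomputable def mulOp (N : MvPolynomial σ k →ₗ[k] MvPolynomial σ k) (i : σ) :
    MvPolynomial σ k →ₗ[k] MvPolynomial σ k :=
  N ∘ₗ LinearMap.mulLeft k (X i) ∘ₗ N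

theorem mulOp_apply (N : MvPolynomial σ k →ₗ[k] MvPolynomial σ k) (i : σ)
    (p : MvPolynomial σ k) : mulOp N i p = N (X i * N p) := rfl

namespace IsNormalForm

variable {N : MvPolynomial σ k →ₗ[k] MvPolynomial σ k}

theorem apply_apply (hN : IsNormalForm V e N) (p : MvPolynomial σ k) : N (N p) = N p :=
  hN.apply_eq_self _ (hN.totalDegree_le p)

theorem apply_mem (hN : IsNormalForm V e N) {p : MvPolynomial σ k}
    (hp : p.totalDegree ≤ e + 1) (h : p ∈ V) : N p ∈ V :=
  sub_sub_cancel p (N p) ▸ V.sub_mem h (hN.sub_mem p hp)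

theorem totalDegree_X_mul_apply_le (hN : IsNormalForm V e N) (i : σ) (p : MvPolynomial σ k) :
    (X i * N p).totalDegree ≤ e + 1 :=
  (totalDegree_X_mul_le i _).trans (Nat.add_le_add_right (hN.totalDegree_le p) 1)

theorem totalDegree_mulOp_le (hN : IsNormalForm V e N) (i : σ) (p : MvPolynomial σ k) :
    (mulOp N i p).totalDegree ≤ e :=
  hN.totalDegree_le _

theorem apply_mulOp (hN : IsNormalForm V e N) (i : σ) (p : MvPolynomial σ k) :
    N (mulOp N i p) = mulOp N i p :=
  hN.apply_apply _

theorem mulOp_mem (hN : IsNormalForm V e N) (hV : IsMulClosedUpTo d V) (hd : e + 1 ≤ d) (i : σ)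
    {p : MvPolynomial σ k} (hp : p.totalDegree ≤ e) (hpV : p ∈ V) : mulOp N i p ∈ V := by
  rw [mulOp_apply]
  refine hN.apply_mem (hN.totalDegree_X_mul_apply_le i p) ?_
  rw [hN.apply_eq_self p hp]
  exact hV.X_mul_mem hpV (by lia) i

theorem X_mul_X_mul_sub_mem (hN : IsNormalForm V e N) (hV : IsMulClosedUpTo d V)
    (hd : e + 1 < d) (i j : σ) (p : MvPolynomial σ k) :
    X i * (X j * N p) - mulOp N i (mulOp N j p) ∈ V := by
  have hj : X j * N p - mulOp N j p ∈ V := hN.sub_mem _ (hN.totalDegree_X_mul_apply_le j p)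
  have hjdeg : (X j * N p - mulOp N j p).totalDegree ≤ e + 1 :=
    (totalDegree_sub _ _).trans (max_le (hN.totalDegree_X_mul_apply_le j p)
      ((hN.totalDegree_mulOp_le j p).trans (Nat.le_succ e)))
  have hi : X i * mulOp N j p - mulOp N i (mulOp N j p) ∈ V := by
    rw [mulOp_apply N i, hN.apply_mulOp]
    exact hN.sub_mem _ ((totalDegree_X_mul_le i _).trans
      (Nat.add_le_add_right (hN.totalDegree_mulOp_le j p) 1))
  have := V.add_mem (hV.X_mul_mem hj (by lia) i) hi
  rwa [mul_sub, sub_add_sub_cancel] at this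

theorem mulOp_eq_C_mul (hN : IsNormalForm V 0 N) (i : σ) (p : MvPolynomial σ k) :
    mulOp N i p = N p * N (X i) := by
  have hp : N p = C ((N p).coeff 0) :=
    totalDegree_eq_zero_iff_eq_C.1 (Nat.le_zero.1 (hN.totalDegree_le p))
  rw [mulOp_apply, hp, mul_comm, ← smul_eq_C_mul, ← smul_eq_C_mul, map_smul]

theorem mulOp_mulOp_sub_mem (hN : IsNormalForm V e N) (hV : IsMulClosedUpTo d V)
    (hd : e + 1 < d ∨ e = 0) (i j : σ) (p : MvPolynomial σ k) :
    mulOp N i (mulOp N j p) - mulOp N j (mulOp N i p) ∈ V := by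
  rcases hd with hlt | rfl
  · have := V.sub_mem (hN.X_mul_X_mul_sub_mem hV hlt j i p) (hN.X_mul_X_mul_sub_mem hV hlt i j p)
    rwa [mul_left_comm, sub_sub_sub_cancel_left] at this
  · have hconst : ∀ i j, mulOp N i (mulOp N j p) = N p * N (X j) * N (X i) := fun i j => by
      rw [hN.mulOp_eq_C_mul, hN.apply_mulOp, hN.mulOp_eq_C_mul]
    rw [hconst, hconst, mul_right_comm, sub_self]
    exact V.zero_mem

/-- Border basis criterion: the multiplications commute modulo `V`, so they make the classes of
the polynomials of degree at most `e` a module over the polynomial ring, generated by `1`. -/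
theorem exists_algHom_end (hN : IsNormalForm V e N) (hV : IsMulClosedUpTo d V) (hd : e + 1 ≤ d)
    (hd' : e + 1 < d ∨ e = 0) :
    ∃ φ : MvPolynomial σ k →ₐ[k]
        Module.End k (MvPolynomial σ k ⧸ V ⊓ restrictTotalDegree σ k e),
      ∀ p : MvPolynomial σ k, p.totalDegree ≤ e + 1 →
        φ p (Submodule.mkQ _ 1) = Submodule.mkQ _ (N p) := by
  set W := V ⊓ restrictTotalDegree σ k e
  have hW : ∀ i, W ≤ W.comap (mulOp N i) := fun i p hp =>
    ⟨hN.mulOp_mem hV hd i ((mem_restrictTotalDegree _ _ _).1 hp.2) hp.1,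
      (mem_restrictTotalDegree _ _ _).2 (hN.totalDegree_mulOp_le i p)⟩
  obtain ⟨φ, hφ⟩ := exists_algHom_X_eq_of_commute (k := k) (fun i => W.mapQ W (mulOp N i) (hW i))
    fun i j => by
      refine Submodule.linearMap_qext _ (LinearMap.ext fun p => (Submodule.Quotient.eq W).2 ?_)
      exact ⟨hN.mulOp_mulOp_sub_mem hV hd' i j p, Submodule.sub_mem _
        ((mem_restrictTotalDegree _ _ _).2 (hN.totalDegree_mulOp_le _ _))
        ((mem_restrictTotalDegree _ _ _).2 (hN.totalDegree_mulOp_le _ _))⟩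
  have hmonomial : ∀ u : σ →₀ ℕ, u.degree ≤ e + 1 →
      φ (monomial u 1) (W.mkQ 1) = W.mkQ (N (monomial u 1)) := by
    intro u hu
    induction hm : u.degree generalizing u with
    | zero =>
      obtain rfl := (Finsupp.degree_eq_zero_iff u).1 hm
      rw [hN.apply_eq_self _ (by simp), monomial_zero', C_1, map_one, Module.End.one_apply]
    | succ m ih =>
      obtain ⟨i, hi⟩ := DFunLike.ne_iff.1 (show u ≠ 0 by rintro rfl; simp at hm)
      obtain ⟨v, rfl⟩ := le_iff_exists_add.1 (Finsupp.single_le_iff.2 (Nat.one_le_iff_ne_zero.2 hi))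
      rw [map_add, Finsupp.degree_single] at hu hm
      rw [monomial_single_add, pow_one, map_mul, Module.End.mul_apply, ih v (by lia) (by lia), hφ,
        Submodule.mkQ_apply, Submodule.mapQ_apply, mulOp_apply, hN.apply_apply,
        hN.apply_eq_self _ ((totalDegree_monomial_le v 1).trans (by lia : v.degree ≤ e)),
        Submodule.mkQ_apply]
  refine ⟨φ, fun p hp => ?_⟩
  refine LinearMap.eqOn_span (f := LinearMap.applyₗ (W.mkQ 1) ∘ₗ φ.toLinearMap)
    (g := W.mkQ ∘ₗ N) ?_ (mem_span_monomial_of_totalDegree_le hp)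
  rintro _ ⟨u, hu, rfl⟩
  exact hmonomial u hu

end IsNormalForm

theorem mem_of_mem_ideal_span_of_totalDegree_le (hV : IsMulClosedUpTo d V) (hd : e + 1 ≤ d)
    (hd' : e + 1 < d ∨ e = 0)
    (hmonomial : ∀ u : σ →₀ ℕ, u.degree = e + 1 → ∃ g ∈ V, (g - monomial u 1).totalDegree ≤ e)
    {F : Set (MvPolynomial σ k)} (hFV : F ⊆ V) (hF : ∀ f ∈ F, f.totalDegree ≤ e + 1)
    {p : MvPolynomial σ k} (hp : p ∈ Ideal.span F) (hpe : p.totalDegree ≤ e) : p ∈ V := by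
  obtain ⟨N, hN⟩ := exists_isNormalForm hmonomial
  obtain ⟨φ, hφ⟩ := hN.exists_algHom_end hV hd hd'
  have hker : φ p (Submodule.mkQ _ 1) = 0 := by
    clear hpe
    induction hp using Submodule.span_induction with
    | mem f hf =>
      rw [hφ f (hF f hf), Submodule.mkQ_apply, Submodule.Quotient.mk_eq_zero]
      exact ⟨hN.apply_mem (hF f hf) (hFV hf),
        (mem_restrictTotalDegree _ _ _).2 (hN.totalDegree_le f)⟩
    | zero => simp
    | add x y _ _ hx hy => rw [map_add, LinearMap.add_apply, hx, hy, add_zero]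
    | smul a x _ hx => rw [smul_eq_mul, map_mul, Module.End.mul_apply, hx, map_zero]
  rw [hφ p (by lia), hN.apply_eq_self p hpe, Submodule.mkQ_apply,
    Submodule.Quotient.mk_eq_zero] at hker
  exact hker.1

end NormalForm

/-! ### Top components and Gröbner bases -/

section TopComponent

open MvPolynomial
open scoped MonomialOrder

theorem totalDegree_sub_le_of_homogeneousComponent_eq {σ k : Type*} [CommRing k] {e : ℕ}
    {f g : MvPolynomial σ k} (hf : f.totalDegree ≤ e + 1) (hg : g.totalDegree ≤ e + 1)
    (h : homogeneousComponent (e + 1) f = homogeneousComponent (e + 1) g) :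
    (f - g).totalDegree ≤ e := by
  refine totalDegree_le_of_coeff fun a ha => Nat.le_of_lt_succ (lt_of_le_of_ne
    ((degree_le_totalDegree ha).trans ((totalDegree_sub f g).trans (max_le hf hg))) fun hae => ?_)
  have hcoeff := congrArg (coeff a) h
  rw [coeff_homogeneousComponent, coeff_homogeneousComponent, if_pos hae, if_pos hae] at hcoeff
  exact ha (by rw [coeff_sub, hcoeff, sub_self])

theorem drl_degree_eq_of_totalDegree_sub_monomial_lt {n : ℕ} {k : Type*} [CommRing k]
    [Nontrivial k] {g : MvPolynomial (Fin n) k} {u : Fin n →₀ ℕ}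
    (h : (g - monomial u 1).totalDegree < u.degree) : (drl n).degree g = u := by
  have hu : (drl n).degree (monomial u (1 : k)) = u := by
    classical rw [MonomialOrder.degree_monomial, if_neg one_ne_zero]
  rw [← add_sub_cancel (monomial u 1) g, MonomialOrder.degree_add_of_lt, hu]
  rw [hu]
  exact (drl_lt_iff _ _).2 (Or.inl (totalDegree_eq_degree_drl_degree (g - monomial u 1) ▸ h))

variable {n : ℕ} {k : Type} [Field k]

theorem homogeneousComponent_monomial_mul (s : Fin n →₀ ℕ) (c : k)
    (f : MvPolynomial (Fin n) k) :
    homogeneousComponent (s.degree + f.totalDegree) (monomial s c * f) =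
      monomial s c * topComponent f := by
  ext a
  rw [coeff_homogeneousComponent, coeff_monomial_mul', coeff_monomial_mul', topComponent,
    coeff_homogeneousComponent]
  by_cases hs : s ≤ a
  · obtain ⟨b, rfl⟩ := le_iff_exists_add.1 hs
    simp [hs]
  · simp [hs]

theorem homogeneousComponent_monomial_mul_topComponent {D : ℕ} (s : Fin n →₀ ℕ) (c : k)
    (f : MvPolynomial (Fin n) k) :
    homogeneousComponent D (monomial s c * topComponent f) =
      if s.degree + f.totalDegree = D then homogeneousComponent D (monomial s c * f) else 0 := by
  have hhom : (monomial s c * topComponent f).IsHomogeneous (s.degree + f.totalDegree) :=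
    (isHomogeneous_monomial c rfl).mul (homogeneousComponent_isHomogeneous _ f)
  rw [homogeneousComponent_of_mem hhom]
  split_ifs with h₁ h₂ h₂
  · rw [← h₂, homogeneousComponent_monomial_mul]
  · exact absurd h₁.symm h₂
  · exact absurd h₂.symm h₁
  · rfl

theorem exists_mem_of_mem_span_topComponent {V : Submodule k (MvPolynomial (Fin n) k)} {d D : ℕ}
    (hV : IsMulClosedUpTo d V) (hD : D ≤ d) {F : Set (MvPolynomial (Fin n) k)} (hFV : F ⊆ V)
    {p : MvPolynomial (Fin n) k} (hp : p ∈ Ideal.span (topComponent '' F)) :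
    ∃ g ∈ V, g.totalDegree ≤ D ∧ homogeneousComponent D g = homogeneousComponent D p := by
  let Q : Submodule k (MvPolynomial (Fin n) k) :=
    ((V ⊓ restrictTotalDegree (Fin n) k D).map (homogeneousComponent D)).comap
      (homogeneousComponent D)
  suffices hmul : ∀ h, h * p ∈ Q by
    obtain ⟨g, ⟨hgV, hgD⟩, hgp⟩ := hmul 1
    exact ⟨g, hgV, (mem_restrictTotalDegree _ _ _).1 hgD, by rwa [one_mul] at hgp⟩
  induction hp using Submodule.span_induction with
  | mem t ht =>
    obtain ⟨f, hf, rfl⟩ := ht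
    intro h
    induction h using induction_on' with
    | monomial s c =>
      rw [Submodule.mem_comap, homogeneousComponent_monomial_mul_topComponent]
      split_ifs with hs
      · refine Submodule.mem_map_of_mem ?_
        rw [show monomial s c = c • monomial s 1 by rw [smul_monomial, smul_eq_mul, mul_one],
          smul_mul_assoc]
        exact Submodule.smul_mem _ _ ⟨hV f (hFV hf) s (by lia),
          (mem_restrictTotalDegree _ _ _).2 ((totalDegree_monomial_mul_le s f).trans hs.le)⟩
      · exact Submodule.zero_mem _
    | add p q hp hq => exact add_mul p q _ ▸ Q.add_mem hp hq
  | zero => exact fun h => (mul_zero h).symm ▸ Q.zero_mem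
  | add x y _ _ hx hy => exact fun h => mul_add h x y ▸ Q.add_mem (hx h) (hy h)
  | smul a x _ hx => exact fun h => by rw [smul_eq_mul, ← mul_assoc]; exact hx _

theorem exists_totalDegree_sub_monomial_le {V : Submodule k (MvPolynomial (Fin n) k)} {d e : ℕ}
    (hV : IsMulClosedUpTo d V) (hd : e + 1 ≤ d) {F : Set (MvPolynomial (Fin n) k)} (hFV : F ⊆ V)
    (hreg : ∀ p : MvPolynomial (Fin n) k, p.IsHomogeneous (e + 1) →
      p ∈ Ideal.span (topComponent '' F)) {u : Fin n →₀ ℕ} (hu : u.degree = e + 1) :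
    ∃ g ∈ V, (g - monomial u 1).totalDegree ≤ e := by
  obtain ⟨g, hgV, hge, hgu⟩ := exists_mem_of_mem_span_topComponent hV hd hFV
    (hreg (monomial u 1) (isHomogeneous_monomial 1 hu))
  exact ⟨g, hgV, totalDegree_sub_le_of_homogeneousComponent_eq hge
    ((totalDegree_monomial_le u 1).trans hu.le) hgu⟩

theorem isGroebnerBasis_of_exists_degree_le {ord : MonomialOrder (Fin n)}
    {G : Set (MvPolynomial (Fin n) k)} {I : Ideal (MvPolynomial (Fin n) k)} (hfin : G.Finite)
    (hspan : Ideal.span G = I) (hmonic : ∀ g ∈ G, ord.Monic g)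
    (hdeg : ∀ p ∈ I, p ≠ 0 → ∃ g ∈ G, ord.degree g ≤ ord.degree p) :
    IsGroebnerBasis ord G I := by
  refine ⟨hfin, hspan, le_antisymm
    (Ideal.span_mono (Set.image_mono (hspan ▸ Ideal.subset_span))) (Ideal.span_le.2 ?_)⟩
  rintro _ ⟨p, hp, rfl⟩
  rcases eq_or_ne p 0 with rfl | hp0
  · simp
  obtain ⟨g, hg, hle⟩ := hdeg p hp hp0
  obtain ⟨b, hb⟩ := le_iff_exists_add'.1 hle
  have hlt : ord.leadingTerm p = monomial b (ord.leadingCoeff p) * ord.leadingTerm g := by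
    rw [MonomialOrder.leadingTerm, MonomialOrder.leadingTerm, hmonic g hg, monomial_mul, mul_one,
      hb]
  exact hlt ▸ Ideal.mul_mem_left _ _ (Ideal.subset_span ⟨g, hg, rfl⟩)

theorem IsReducedSystem.isGroebnerBasis_of_isMulClosedUpTo {G : List (MvPolynomial (Fin n) k)}
    (hG : IsReducedSystem (drl n) G) {d e : ℕ}
    (hV : IsMulClosedUpTo d (Submodule.span k {g | g ∈ G})) (hd : e + 1 ≤ d)
    (hd' : e + 1 < d ∨ e = 0) {F : Set (MvPolynomial (Fin n) k)}
    (hFV : F ⊆ Submodule.span k {g | g ∈ G}) (hF : ∀ f ∈ F, f.totalDegree ≤ e + 1)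
    (hreg : ∀ p : MvPolynomial (Fin n) k, p.IsHomogeneous (e + 1) →
      p ∈ Ideal.span (topComponent '' F))
    (hGI : ∀ g ∈ G, g ∈ Ideal.span F) :
    IsGroebnerBasis (drl n) {g | g ∈ G} (Ideal.span F) := by
  have hmonomial : ∀ u : Fin n →₀ ℕ, u.degree = e + 1 →
      ∃ g ∈ Submodule.span k {g | g ∈ G}, (g - monomial u 1).totalDegree ≤ e :=
    fun u hu => exists_totalDegree_sub_monomial_le hV hd hFV hreg hu
  have hspan : Ideal.span {g | g ∈ G} = Ideal.span F :=
    le_antisymm (Ideal.span_le.2 hGI) (Ideal.span_le.2 fun f hf =>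
      Submodule.span_le_restrictScalars k (MvPolynomial (Fin n) k) _ (hFV hf))
  refine isGroebnerBasis_of_exists_degree_le (List.finite_toSet G) hspan hG.monic
    fun p hp hp0 => ?_
  rcases le_or_gt p.totalDegree e with hpe | hpe
  · obtain ⟨g, hg, hdeg⟩ := hG.exists_degree_eq
      (mem_of_mem_ideal_span_of_totalDegree_le hV hd hd' hmonomial hFV hF hp hpe) hp0
    exact ⟨g, hg, hdeg.le⟩
  · rw [totalDegree_eq_degree_drl_degree] at hpe
    obtain ⟨u, hu, hue⟩ := Finsupp.exists_le_degree_eq _ (e + 1) hpe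
    obtain ⟨h, hhV, hhu⟩ := hmonomial u hue
    have hhdeg : (drl n).degree h = u :=
      drl_degree_eq_of_totalDegree_sub_monomial_lt (by lia)
    have hh0 : h ≠ 0 := by
      rintro rfl
      rw [MonomialOrder.degree_zero] at hhdeg
      simp [← hhdeg] at hue
    obtain ⟨g, hg, hdeg⟩ := hG.exists_degree_eq hhV hh0
    exact ⟨g, hg, by rwa [hdeg, hhdeg]⟩

end TopComponent

theorem RowReduction.isGroebnerBasis_output (E : RowReduction) {q n d e : ℕ} [Fact q.Prime]
    {F : List (MvPolynomial (Fin n) (ZMod q))} (hd : e + 1 ≤ d) (hd' : e + 1 < d ∨ e = 0)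
    (hF : ∀ f ∈ F, f.totalDegree ≤ e + 1)
    (hreg : ∀ p : MvPolynomial (Fin n) (ZMod q), p.IsHomogeneous (e + 1) →
      p ∈ Ideal.span (topComponent '' {f | f ∈ F})) :
    IsGroebnerBasis (drl n) {g | g ∈ E.output d F} (Ideal.span {f | f ∈ F}) :=
  (E.isReducedSystem_output d F).isGroebnerBasis_of_isMulClosedUpTo
    (E.isMulClosedUpTo_span_output d F) hd hd'
    (Submodule.span_le.1 (E.span_le_span_output fun f hf => (hF f hf).trans hd)) hF hreg
    (E.mem_ideal_of_mem_system (fun _ hf => Ideal.subset_span hf) _)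

/-! ### LWE polynomials -/

section LinearForm

open MvPolynomial

section CommRing

variable {σ k : Type*} [CommRing k]

theorem totalDegree_aeval_le_of_isHomogeneous_one {y : MvPolynomial σ k} (hy : y.IsHomogeneous 1)
    (p : Polynomial k) : (Polynomial.aeval y p).totalDegree ≤ p.natDegree := by
  rw [Polynomial.aeval_eq_sum_range]
  refine totalDegree_finsetSum_le fun i hi => (totalDegree_smul_le _ _).trans ?_
  exact ((one_mul i ▸ hy.pow i).totalDegree_le).trans (Finset.mem_range_succ_iff.1 hi)

theorem homogeneousComponent_natDegree_aeval {y : MvPolynomial σ k} (hy : y.IsHomogeneous 1)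
    (p : Polynomial k) :
    homogeneousComponent p.natDegree (Polynomial.aeval y p) =
      p.leadingCoeff • y ^ p.natDegree := by
  have hpow : ∀ i, y ^ i ∈ homogeneousSubmodule σ k i := fun i => by simpa using hy.pow i
  rw [Polynomial.aeval_eq_sum_range, map_sum, Finset.sum_eq_single p.natDegree]
  · rw [map_smul, homogeneousComponent_of_mem (hpow _), if_pos rfl, Polynomial.leadingCoeff]
  · intro i _ hi
    rw [map_smul, homogeneousComponent_of_mem (hpow i), if_neg hi.symm, smul_zero]
  · simp

theorem aeval_C_sub (c : k) (l : MvPolynomial σ k) (p : Polynomial k) :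
    Polynomial.aeval (C c - l) p = Polynomial.aeval (-l) (Polynomial.taylor c p) := by
  rw [Polynomial.taylor_apply, Polynomial.aeval_comp]
  simp [sub_eq_neg_add, algebraMap_eq]

variable [Fintype σ]

/-- The linear form with the given coefficients. -/
noncomputable def linForm (a : σ → k) : MvPolynomial σ k :=
  ∑ j, C (a j) * X j

theorem linForm_zero : linForm (0 : σ → k) = 0 := by
  simp [linForm]

theorem coeff_linForm (a : σ → k) (j : σ) : (linForm a).coeff (Finsupp.single j 1) = a j := by
  classical
  simp [linForm, coeff_sum, coeff_C_mul, coeff_X, Finsupp.single_left_inj one_ne_zero]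

theorem linForm_ne_zero {a : σ → k} (ha : a ≠ 0) : linForm a ≠ 0 := by
  obtain ⟨j, hj⟩ := Function.ne_iff.1 ha
  exact fun h => hj (by rw [← coeff_linForm a j, h, coeff_zero, Pi.zero_apply])

theorem isHomogeneous_neg_linForm (a : σ → k) : (-linForm a).IsHomogeneous 1 :=
  (IsHomogeneous.sum _ _ _ fun j _ => by
    simpa using (isHomogeneous_C σ (a j)).mul (isHomogeneous_X k j)).neg

theorem totalDegree_aeval_C_sub_linForm_le (c : k) (a : σ → k) (p : Polynomial k) :
    (Polynomial.aeval (C c - linForm a) p).totalDegree ≤ p.natDegree := by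
  rw [aeval_C_sub, ← Polynomial.natDegree_taylor p c]
  exact totalDegree_aeval_le_of_isHomogeneous_one (isHomogeneous_neg_linForm a) _

theorem aeval_C_sub_linForm_zero (c : k) (p : Polynomial k) :
    Polynomial.aeval (C c - linForm (0 : σ → k)) p = C (p.eval c) := by
  rw [linForm_zero, sub_zero, ← algebraMap_eq, Polynomial.aeval_algebraMap_apply,
    Polynomial.coe_aeval_eq_eval]

end CommRing

variable {n : ℕ} {k : Type} [Field k]

theorem topComponent_C (c : k) : topComponent (C c : MvPolynomial (Fin n) k) = C c := by
  rw [topComponent, totalDegree_C, homogeneousComponent_zero, coeff_zero_C]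

theorem topComponent_aeval_C_sub_linForm {c : k} {a : Fin n → k} {p : Polynomial k}
    (hp : p.Monic) (hp0 : p.natDegree ≠ 0) (ha : a = 0 → p.eval c = 0) :
    topComponent (Polynomial.aeval (C c - linForm a) p) = (-linForm a) ^ p.natDegree := by
  rcases eq_or_ne a 0 with rfl | ha0
  · rw [aeval_C_sub_linForm_zero, ha rfl, topComponent_C, linForm_zero, neg_zero, zero_pow hp0,
      C_0]
  have htop : homogeneousComponent p.natDegree (Polynomial.aeval (C c - linForm a) p) =
      (-linForm a) ^ p.natDegree := by
    have h := homogeneousComponent_natDegree_aeval (isHomogeneous_neg_linForm a)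
      (Polynomial.taylor c p)
    rwa [← aeval_C_sub, Polynomial.natDegree_taylor, Polynomial.leadingCoeff_taylor,
      hp.leadingCoeff, one_smul] at h
  have hdeg : (Polynomial.aeval (C c - linForm a) p).totalDegree = p.natDegree := by
    refine le_antisymm (totalDegree_aeval_C_sub_linForm_le c a p) (not_lt.1 fun hlt => ?_)
    exact pow_ne_zero _ (neg_ne_zero.2 (linForm_ne_zero ha0))
      (htop ▸ homogeneousComponent_eq_zero _ _ hlt)
  rw [topComponent, hdeg, htop]

end LinearForm

section LWESystem

open MvPolynomial

variable {q : ℕ} [Fact q.Prime]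

theorem monic_X_add_C_mul_X_sub_C {k : Type*} [CommRing k] (c : k) :
    ((Polynomial.X + Polynomial.C c) * (Polynomial.X - Polynomial.C c)).Monic :=
  (Polynomial.monic_X_add_C c).mul (Polynomial.monic_X_sub_C c)

theorem lweErrorPoly_monic (q N : ℕ) [Fact q.Prime] : (lweErrorPoly q N).Monic :=
  Polynomial.monic_X.mul (Polynomial.monic_prod_of_monic _ _ fun _ _ =>
    monic_X_add_C_mul_X_sub_C _)

theorem natDegree_lweErrorPoly (q N : ℕ) [Fact q.Prime] :
    (lweErrorPoly q N).natDegree = 2 * N + 1 := by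
  rw [lweErrorPoly, Polynomial.monic_X.natDegree_mul (Polynomial.monic_prod_of_monic _ _
    fun i _ => monic_X_add_C_mul_X_sub_C _), Polynomial.natDegree_prod_of_monic _ _
    fun i _ => monic_X_add_C_mul_X_sub_C _, Polynomial.natDegree_X]
  simp only [(Polynomial.monic_X_add_C _).natDegree_mul (Polynomial.monic_X_sub_C _),
    Polynomial.natDegree_X_add_C, Polynomial.natDegree_X_sub_C, Finset.sum_const, Nat.card_Icc,
    smul_eq_mul]
  lia

theorem eval_lweErrorPoly {N : ℕ} {e : ℤ} (he : |e| ≤ N) :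
    (lweErrorPoly q N).eval (e : ZMod q) = 0 := by
  rw [lweErrorPoly, Polynomial.eval_mul, Polynomial.eval_prod, Polynomial.eval_X]
  rcases eq_or_ne e 0 with rfl | h0
  · simp
  refine mul_eq_zero_of_right _ (Finset.prod_eq_zero (i := e.natAbs) ?_ ?_)
  · rw [Int.abs_eq_natAbs] at he
    rw [Finset.mem_Icc]
    lia
  · rcases Int.natAbs_eq e with h | h <;>
    · rw [h]
      simp

variable {n m N : ℕ} {S : Fin m → (Fin n → ZMod q) × ZMod q}

theorem mem_lweSystem {f : MvPolynomial (Fin n) (ZMod q)} :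
    f ∈ lweSystem N S ↔
      ∃ i, Polynomial.aeval (C (S i).2 - linForm (S i).1) (lweErrorPoly q N) = f := by
  rw [lweSystem, List.mem_ofFn]
  rfl

theorem length_lweSystem (N : ℕ) (S : Fin m → (Fin n → ZMod q) × ZMod q) :
    (lweSystem N S).length = m :=
  List.length_ofFn

theorem totalDegree_le_of_mem_lweSystem {f : MvPolynomial (Fin n) (ZMod q)}
    (hf : f ∈ lweSystem N S) : f.totalDegree ≤ 2 * N + 1 := by
  obtain ⟨i, rfl⟩ := mem_lweSystem.1 hf
  exact natDegree_lweErrorPoly q N ▸ totalDegree_aeval_C_sub_linForm_le _ _ _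

theorem eval_eq_zero_of_mem_lweSystem {s : Fin n → ZMod q} {w : Fin m → (Fin n → ZMod q) × ℤ}
    (hw : ∀ i, |(w i).2| ≤ N) {f : MvPolynomial (Fin n) (ZMod q)}
    (hf : f ∈ lweSystem N fun i => lweSample s (w i)) : eval s f = 0 := by
  obtain ⟨i, rfl⟩ := mem_lweSystem.1 hf
  have herr : aeval s (C (lweSample s (w i)).2 - linForm (lweSample s (w i)).1) =
      ((w i).2 : ZMod q) := by
    simp [lweSample, linForm, dotProduct, mul_comm]
  rw [← coe_aeval_eq_eval, RingHom.coe_coe, ← Polynomial.aeval_algHom_apply, herr,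
    Polynomial.coe_aeval_eq_eval]
  exact eval_lweErrorPoly (hw i)

theorem image_topComponent_lweSystem
    (hS : ∀ i, (S i).1 = 0 → (lweErrorPoly q N).eval (S i).2 = 0) :
    topComponent '' {f | f ∈ lweSystem N S} =
      Set.range fun i => (-linForm (S i).1) ^ (2 * N + 1) := by
  have htop : ∀ i, topComponent (Polynomial.aeval (C (S i).2 - linForm (S i).1)
      (lweErrorPoly q N)) = (-linForm (S i).1) ^ (2 * N + 1) := fun i => by
    rw [← natDegree_lweErrorPoly q N]
    exact topComponent_aeval_C_sub_linForm (lweErrorPoly_monic q N)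
      (by rw [natDegree_lweErrorPoly]; lia) (hS i)
  simp only [mem_lweSystem, ← htop]
  exact (Set.range_comp topComponent _).symm

theorem hasDegreeOfRegularity_lweSystem_iff {D : ℕ}
    (hS : ∀ i, (S i).1 = 0 → (lweErrorPoly q N).eval (S i).2 = 0) :
    HasDegreeOfRegularity {f | f ∈ lweSystem N S} D ↔
      HasDegreeOfRegularity {f | f ∈ lweSystem N fun i => ((S i).1, 0)} D := by
  rw [HasDegreeOfRegularity, HasDegreeOfRegularity, image_topComponent_lweSystem hS,
    image_topComponent_lweSystem fun i _ => by
      simpa using eval_lweErrorPoly (q := q) (N := N) (e := 0) (by simp)]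

theorem eval_eq_zero_of_hasDegreeOfRegularity {D : ℕ} (hD : 0 < D)
    (hS : HasDegreeOfRegularity {f | f ∈ lweSystem N S} D) {i : Fin m} (hi : (S i).1 = 0) :
    (lweErrorPoly q N).eval (S i).2 = 0 := by
  by_contra hne
  have hmem : C ((lweErrorPoly q N).eval (S i).2) ∈
      Ideal.span (topComponent '' {f | f ∈ lweSystem N S}) :=
    Ideal.subset_span ⟨_, mem_lweSystem.2 ⟨i, rfl⟩, by
      rw [hi, aeval_C_sub_linForm_zero, topComponent_C]⟩
  have htop := Ideal.eq_top_of_isUnit_mem _ hmem ((Ne.isUnit hne).map C)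
  exact hD.not_ge (hS.2 fun p _ => htop ▸ Submodule.mem_top)

end LWESystem

/-! ### Bounds for binomial coefficients -/

theorem choose_le_exp {a : ℕ} (ha : 0 < a) (b : ℕ) :
    ((a + b).choose a : ℝ) ≤ Real.exp (a * (1 + Real.log ((a + b) / a))) := by
  have ha' : (0 : ℝ) < a := Nat.cast_pos.2 ha
  calc ((a + b).choose a : ℝ) ≤ ((a + b : ℕ) : ℝ) ^ a / a.factorial := Nat.choose_le_pow_div a _
    _ = (a : ℝ) ^ a / a.factorial * ((a + b) / a : ℝ) ^ a := by
      rw [div_pow, Nat.cast_add]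
      field_simp
    _ ≤ Real.exp a * ((a + b) / a : ℝ) ^ a := by
      gcongr
      exact Real.pow_div_factorial_le_exp _ ha'.le a
    _ = Real.exp (a * (1 + Real.log ((a + b) / a))) := by
      rw [mul_add, mul_one, Real.exp_add, ← Real.log_pow, Real.exp_log (by positivity)]

theorem log_four_eq_two_mul_log_two : Real.log 4 = 2 * Real.log 2 := by
  rw [show (4 : ℝ) = 2 ^ 2 by norm_num, Real.log_pow, Nat.cast_two]

theorem one_div_log_four_gt_d4 : 0.7213 < 1 / Real.log 4 := by
  have h₁ := Real.log_two_gt_d9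
  have h₂ := Real.log_two_lt_d9
  rw [log_four_eq_two_mul_log_two, lt_div_iff₀ (by linarith)]
  linarith

theorem one_div_log_four_lt_d3 : 1 / Real.log 4 < 0.722 := by
  have h₁ := Real.log_two_gt_d9
  rw [log_four_eq_two_mul_log_two, div_lt_iff₀ (by linarith)]
  linarith

theorem two_mul_exp_neg_one_div_log_four_sub_half_le :
    2 * Real.exp (-(1 / Real.log 4) - 1 / 2) ≤
      1.15 * Real.exp 1 * (Real.log 2 - 1 / 2) := by
  have hl := Real.log_two_gt_d9
  have he := Real.exp_one_gt_d9
  have hexp : 9.01 ≤ Real.exp 1 * (Real.exp 1 * Real.exp 0.22) := by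
    have h := Real.add_one_le_exp (0.22 : ℝ)
    calc (9.01 : ℝ) ≤ 2.7182818283 * (2.7182818283 * (0.22 + 1)) := by norm_num
      _ ≤ _ := by gcongr
  have hinv : Real.exp (-1.22) ≤ Real.exp 1 / 9.01 := by
    rw [le_div_iff₀ (by norm_num)]
    calc Real.exp (-1.22) * 9.01
        ≤ Real.exp (-1.22) * (Real.exp 1 * (Real.exp 1 * Real.exp 0.22)) := by gcongr
      _ = Real.exp 1 := by
        rw [← Real.exp_add, ← Real.exp_add, ← Real.exp_add]
        norm_num
  calc 2 * Real.exp (-(1 / Real.log 4) - 1 / 2) ≤ 2 * Real.exp (-1.22) := by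
        gcongr
        linarith [one_div_log_four_gt_d4]
    _ ≤ 2 * (Real.exp 1 / 9.01) := by gcongr
    _ = Real.exp 1 * (2 / 9.01) := by ring
    _ ≤ Real.exp 1 * (1.15 * (Real.log 2 - 1 / 2)) := by
        gcongr
        linarith
    _ = _ := by ring

/- Since `(1 - 1 / log 4) log 2 = log 2 - 1 / 2`, the tangent line bound `y ≤ exp (y - 1)` at
`y = (1 - 1 / log 4) (1 + log (1 + r))` produces exactly the power `r ^ (1 - 1 / log 4)`. -/
theorem one_add_log_one_add_le {r : ℝ} (hr : 1 ≤ r) :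
    1 + Real.log (1 + r) ≤
      1.15 * Real.exp 1 * Real.log 2 * r ^ (1 - 1 / Real.log 4) := by
  set β := 1 - 1 / Real.log 4 with hβ
  have hβ_pos : 0 < β := by linarith [one_div_log_four_lt_d3]
  have hβ_mul : β * Real.log 2 = Real.log 2 - 1 / 2 := by
    have := Real.log_pos one_lt_two
    rw [hβ, log_four_eq_two_mul_log_two]
    field_simp
  have hlog : Real.log (1 + r) ≤ Real.log 2 + Real.log r := by
    rw [← Real.log_mul two_ne_zero (by linarith)]
    exact Real.log_le_log (by linarith) (by linarith)
  refine le_of_mul_le_mul_left ?_ hβ_pos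
  calc β * (1 + Real.log (1 + r)) ≤ Real.exp (β * (1 + Real.log (1 + r)) - 1) := by
        linarith [Real.add_one_le_exp (β * (1 + Real.log (1 + r)) - 1)]
    _ ≤ Real.exp (β * (1 + (Real.log 2 + Real.log r)) - 1) := by gcongr
    _ = Real.exp (Real.log 2 + (-(1 / Real.log 4) - 1 / 2) + Real.log r * β) := by
        congr 1
        linear_combination hβ_mul + hβ
    _ = 2 * Real.exp (-(1 / Real.log 4) - 1 / 2) * r ^ β := by
        rw [Real.exp_add, Real.exp_add, Real.exp_log two_pos,
          ← Real.rpow_def_of_pos (by linarith)]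
    _ ≤ 1.15 * Real.exp 1 * (Real.log 2 - 1 / 2) * r ^ β := by
        gcongr ?_ * _
        exact two_mul_exp_neg_one_div_log_four_sub_half_le
    _ = β * (1.15 * Real.exp 1 * Real.log 2 * r ^ β) := by rw [← hβ_mul]; ring

/-- The exponent `2^(1/log 2) · a^(1/log 4) · b^(1 - 1/log 4)` in the complexity estimates; up to a
constant factor it bounds the binary logarithm of `binom (a + b) a`. -/
noncomputable def growthExponent (a b : ℝ) : ℝ :=
  2 ^ (1 / Real.log 2) * a ^ (1 / Real.log 4) * b ^ (1 - 1 / Real.log 4)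

theorem mul_growthExponent (c a b : ℝ) :
    c * growthExponent a b =
      c * 2 ^ (1 / Real.log 2) * a ^ (1 / Real.log 4) * b ^ (1 - 1 / Real.log 4) := by
  simp only [growthExponent, mul_assoc]

theorem growthExponent_eq (a b : ℝ) :
    growthExponent a b =
      Real.exp 1 * a ^ (1 / Real.log 4) * b ^ (1 - 1 / Real.log 4) := by
  rw [growthExponent, Real.rpow_def_of_pos two_pos,
    mul_one_div_cancel (Real.log_pos one_lt_two).ne']

theorem growthExponent_eq_mul_div_rpow {x y : ℝ} (hx : 0 < x) (hy : 0 ≤ y) :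
    growthExponent x y = Real.exp 1 * (x * (y / x) ^ (1 - 1 / Real.log 4)) := by
  rw [growthExponent_eq, Real.div_rpow hy hx.le, Real.rpow_sub hx, Real.rpow_one]
  field_simp

theorem growthExponent_nonneg {a b : ℝ} (ha : 0 ≤ a) (hb : 0 ≤ b) : 0 ≤ growthExponent a b := by
  unfold growthExponent
  positivity

theorem growthExponent_le_growthExponent_swap {x y : ℝ} (hx : 0 < x) (hxy : x ≤ y) :
    growthExponent x y ≤ growthExponent y x := by
  have hy := hx.trans_le hxy
  have hexp : 1 - 1 / Real.log 4 ≤ 1 / Real.log 4 := by linarith [one_div_log_four_gt_d4]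
  calc growthExponent x y = Real.exp 1 * (x * (y / x) ^ (1 - 1 / Real.log 4)) :=
        growthExponent_eq_mul_div_rpow hx hy.le
    _ ≤ Real.exp 1 * (x * (y / x) ^ (1 / Real.log 4)) := by
        gcongr
        rwa [one_le_div hx]
    _ = growthExponent y x := by
        rw [growthExponent_eq, Real.div_rpow hy.le hx.le, Real.rpow_sub hx, Real.rpow_one]
        field_simp

theorem mul_one_add_log_le_growthExponent {x y : ℝ} (hx : 0 < x) (hxy : x ≤ y) :
    x * (1 + Real.log ((x + y) / x)) ≤ Real.log 2 * (1.15 * growthExponent x y) := by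
  rw [growthExponent_eq_mul_div_rpow hx (hx.le.trans hxy), add_div, div_self hx.ne']
  calc x * (1 + Real.log (1 + y / x))
      ≤ x * (1.15 * Real.exp 1 * Real.log 2 * (y / x) ^ (1 - 1 / Real.log 4)) := by
        gcongr
        exact one_add_log_one_add_le ((one_le_div hx).2 hxy)
    _ = _ := by ring

theorem choose_le_two_rpow_growthExponent {a b : ℕ} (ha : 0 < a) (hb : 0 < b) :
    ((a + b).choose a : ℝ) ≤ 2 ^ (1.15 * growthExponent a b) := by
  have choose_le {a b : ℕ} (ha : 0 < a) (hab : a ≤ b) :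
      ((a + b).choose a : ℝ) ≤ 2 ^ (1.15 * growthExponent a b) := by
    rw [Real.rpow_def_of_pos two_pos]
    exact (choose_le_exp ha b).trans <| Real.exp_le_exp.2 <|
      mul_one_add_log_le_growthExponent (Nat.cast_pos.2 ha) (Nat.cast_le.2 hab)
  rcases le_total a b with hab | hba
  · exact choose_le ha hab
  · rw [Nat.choose_symm_add, add_comm a b]
    refine (choose_le hb hba).trans ?_
    gcongr
    · exact one_le_two
    · exact growthExponent_le_growthExponent_swap (Nat.cast_pos.2 hb) (Nat.cast_le.2 hba)

theorem sqrt_le_growthExponent {x y : ℝ} (hx : 1 ≤ x) (hy : 1 ≤ y) :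
    2.7 * √x ≤ growthExponent (2 * x - 1) y := by
  have hsqrt : √x ≤ (2 * x - 1) ^ (1 / Real.log 4) := by
    rw [Real.sqrt_eq_rpow]
    calc x ^ (1 / 2 : ℝ) ≤ (2 * x - 1) ^ (1 / 2 : ℝ) := by
          gcongr
          linarith
      _ ≤ _ := Real.rpow_le_rpow_of_exponent_le (by linarith)
          (by linarith [one_div_log_four_gt_d4])
  have hy' : 1 ≤ y ^ (1 - 1 / Real.log 4) :=
    Real.one_le_rpow hy (by linarith [one_div_log_four_lt_d3])
  rw [growthExponent_eq]
  calc 2.7 * √x = 2.7 * √x * 1 := (mul_one _).symm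
    _ ≤ Real.exp 1 * (2 * x - 1) ^ (1 / Real.log 4) * y ^ (1 - 1 / Real.log 4) := by
      have : 0 ≤ 2 * x - 1 := by linarith
      gcongr
      linarith [Real.exp_one_gt_d9]

theorem sq_le_two_rpow_growthExponent {x y : ℝ} (hx : 1 ≤ x) (hy : 1 ≤ y) :
    x ^ 2 ≤ 1000 * 2 ^ (0.25 * growthExponent (2 * x - 1) y) := by
  have hlog : 0.45 * √x ≤ Real.log 2 * (0.25 * growthExponent (2 * x - 1) y) := by
    calc 0.45 * √x ≤ 0.69 * (0.25 * (2.7 * √x)) := by linarith [Real.sqrt_nonneg x]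
      _ ≤ _ := by
        gcongr
        · linarith [Real.log_two_gt_d9]
        · exact sqrt_le_growthExponent hx hy
  have hfour : (0.45 * √x) ^ 4 = 0.45 ^ 4 * x ^ 2 := by
    rw [mul_pow, show √x ^ 4 = (√x ^ 2) ^ 2 by ring, Real.sq_sqrt (by linarith)]
  calc x ^ 2 ≤ 1000 * (0.45 ^ 4 * x ^ 2 / Nat.factorial 4) := by
        norm_num [Nat.factorial]
        linarith [sq_nonneg x]
    _ ≤ 1000 * Real.exp (0.45 * √x) := by
        rw [← hfour]
        gcongr
        exact Real.pow_div_factorial_le_exp _ (by positivity) 4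
    _ ≤ 1000 * 2 ^ (0.25 * growthExponent (2 * x - 1) y) := by
        rw [Real.rpow_def_of_pos two_pos]
        gcongr

theorem choose_succ_succ_le_mul (a b : ℕ) :
    (a + b + 1).choose (b + 1) ≤ (a + 1) * (a + b).choose b := by
  refine Nat.le_of_mul_le_mul_right (c := b + 1) ?_ b.succ_pos
  rw [← Nat.add_one_mul_choose_eq, mul_right_comm]
  exact Nat.mul_le_mul_right _ (by linarith [Nat.zero_le (a * b)])

theorem length_drlMonomials_le {n d : ℕ} (hn : 2 ≤ n) (hd : 0 < d) :
    ((drlMonomials n d).length : ℝ) ≤ (d + 1) * 2 ^ (1.15 * growthExponent d (n - 1)) := by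
  obtain ⟨n, rfl⟩ : ∃ l, n = l + 1 := ⟨n - 1, by omega⟩
  rw [length_drlMonomials, Nat.cast_succ n, add_sub_cancel_right]
  calc ((d + (n + 1)).choose (n + 1) : ℝ) ≤ (d + 1) * (d + n).choose n := by
        exact_mod_cast choose_succ_succ_le_mul d n
    _ ≤ _ := by
        rw [← Nat.choose_symm_add]
        gcongr
        exact choose_le_two_rpow_growthExponent hd (by omega)

theorem length_drlMonomials_rpow_le {n D : ℕ} (hn : 2 ≤ n) (hD : 0 < D) {p : ℝ} (hp : 0 ≤ p)
    (hp' : p ≤ 5) :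
    ((drlMonomials n (2 * D - 1)).length : ℝ) ^ p ≤
      32000 * ((D : ℝ) ^ 3 * 2 ^ ((p + 1) * growthExponent (2 * D - 1) (n - 1))) := by
  have hD' : (1 : ℝ) ≤ D := by exact_mod_cast hD
  have hn' : (1 : ℝ) ≤ n - 1 := by
    have : (2 : ℝ) ≤ n := by exact_mod_cast hn
    linarith
  have hcast : ((2 * D - 1 : ℕ) : ℝ) = 2 * D - 1 := by
    rw [Nat.cast_sub (by omega)]
    push_cast
    rfl
  have hL := length_drlMonomials_le hn (d := 2 * D - 1) (by omega)
  rw [hcast, sub_add_cancel] at hL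
  have hsq := sq_le_two_rpow_growthExponent hD' hn'
  have hX := growthExponent_nonneg (a := 2 * D - 1) (by linarith) (zero_le_one.trans hn')
  set X := growthExponent (2 * D - 1) (n - 1)
  have h2D : (2 * D : ℝ) ^ p ≤ 32 * (D : ℝ) ^ 5 := by
    calc (2 * D : ℝ) ^ p ≤ (2 * D : ℝ) ^ (5 : ℝ) :=
          Real.rpow_le_rpow_of_exponent_le (by linarith) hp'
      _ = 32 * (D : ℝ) ^ 5 := by
        rw [show (5 : ℝ) = (5 : ℕ) by norm_num, Real.rpow_natCast]
        ring
  calc ((drlMonomials n (2 * D - 1)).length : ℝ) ^ p ≤ (2 * D * 2 ^ (1.15 * X)) ^ p := by gcongr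
    _ = (2 * D : ℝ) ^ p * 2 ^ (1.15 * X * p) := by
        rw [Real.mul_rpow (by positivity) (by positivity), ← Real.rpow_mul zero_le_two]
    _ ≤ 32 * (D : ℝ) ^ 5 * 2 ^ (1.15 * X * p) := by gcongr
    _ = 32 * (D : ℝ) ^ 3 * ((D : ℝ) ^ 2 * 2 ^ (1.15 * X * p)) := by ring
    _ ≤ 32 * (D : ℝ) ^ 3 * (1000 * 2 ^ (0.25 * X) * 2 ^ (1.15 * X * p)) := by gcongr
    _ = 32000 * ((D : ℝ) ^ 3 * 2 ^ (0.25 * X + 1.15 * X * p)) := by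
        rw [Real.rpow_add two_pos]
        ring
    _ ≤ 32000 * ((D : ℝ) ^ 3 * 2 ^ ((p + 1) * X)) := by
        gcongr
        · exact one_le_two
        · nlinarith

/-! ### Time and memory -/

theorem ArithProg.card_registers_le {k o : Type} [Field k] [DecidableEq k] [Fintype o]
    (p : ArithProg k o) (ρ : ℕ → k) :
    (p.registers ρ).card ≤ 3 * p.steps ρ + Fintype.card o := by
  have card_triple (r x y : ℕ) : ({r, x, y} : Finset ℕ).card ≤ 3 := Finset.card_le_three
  induction p generalizing ρ with
  | halt out => simpa [registers, steps] using Finset.card_image_le (s := Finset.univ) (f := out)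
  | const r c p ih =>
    refine (Finset.card_union_le _ _).trans ?_
    have := ih (Function.update ρ r c)
    simp only [Finset.card_singleton, steps]
    omega
  | add r x y p ih | sub r x y p ih | mul r x y p ih | div r x y p ih =>
    refine (Finset.card_union_le _ _).trans
      ((Nat.add_le_add (card_triple _ _ _) (ih _)).trans ?_)
    simp only [steps]
    omega
  | ifZero x p p' ih ih' =>
    refine (Finset.card_union_le _ _).trans ?_
    have := ih ρ
    have := ih' ρ
    simp only [Finset.card_singleton, steps]
    split_ifs <;> omega

namespace RowReduction

variable {E : RowReduction} {q n d : ℕ} [Fact q.Prime]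
  {F : List (MvPolynomial (Fin n) (ZMod q))} {ω c κ : ℝ}

theorem space_le (E : RowReduction) {a b : ℕ} (A : Matrix (Fin a) (Fin b) (ZMod q)) :
    E.space A ≤ 2 * (a * b) + 3 * E.steps A := by
  have hregisters := ArithProg.card_registers_le (E.prog q a b) (loadMatrix A)
  rw [Fintype.card_prod, Fintype.card_fin, Fintype.card_fin] at hregisters
  refine (Finset.card_union_le _ _).trans ?_
  rw [Finset.card_range, steps]
  omega

/-- `E` reduces an `a × b` matrix of rank `r` in at most `c · a · b · max(r, 1)^(ω-2)` steps: the
bound of `RowReduction.HasExponent` with a prescribed constant. -/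
def HasStepBound (E : RowReduction) (ω c : ℝ) : Prop :=
  ∀ (q : ℕ) [Fact q.Prime] (a b : ℕ) (A : Matrix (Fin a) (Fin b) (ZMod q)),
    (E.steps A : ℝ) ≤ c * a * b * (max A.rank 1 : ℝ) ^ (ω - 2)

theorem HasExponent.exists_hasStepBound (hE : E.HasExponent ω) :
    ∃ c, 0 ≤ c ∧ E.HasStepBound ω c := by
  obtain ⟨c, hc⟩ := hE
  refine ⟨max c 0, le_max_right _ _, fun q _ a b A => (hc q a b A).trans ?_⟩
  gcongr
  exact le_max_left _ _

theorem length_macaulayRows_mul_le (hF : (F.length : ℝ) ≤ κ * (drlMonomials n d).length) :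
    ((macaulayRows d F).length : ℝ) * (drlMonomials n d).length ≤
      κ * (drlMonomials n d).length ^ 3 := by
  set L := (drlMonomials n d).length
  calc ((macaulayRows d F).length : ℝ) * L ≤ (F.length * L) * L := by
        gcongr
        exact_mod_cast length_macaulayRows_le d F
    _ ≤ (κ * L * L) * L := by gcongr
    _ = κ * L ^ 3 := by ring

theorem length_drlMonomials_pow_three_le (n d : ℕ) (hω : 2 ≤ ω) :
    ((drlMonomials n d).length : ℝ) ^ 3 ≤ (drlMonomials n d).length ^ (ω + 1) := by
  rw [← Real.rpow_natCast]
  refine Real.rpow_le_rpow_of_exponent_le (by exact_mod_cast one_le_length_drlMonomials n d) ?_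
  push_cast
  linarith

theorem HasStepBound.steps_macaulayMatrix_le (hE : E.HasStepBound ω c) (hω : 2 ≤ ω) (hc : 0 ≤ c)
    (hκ : 0 ≤ κ) (hF : (F.length : ℝ) ≤ κ * (drlMonomials n d).length) :
    (E.steps (macaulayMatrix d F) : ℝ) ≤ c * κ * (drlMonomials n d).length ^ (ω + 1) := by
  have hL : (1 : ℝ) ≤ (drlMonomials n d).length := by
    exact_mod_cast one_le_length_drlMonomials n d
  have hrank : ((macaulayMatrix d F).rank : ℝ) ≤ (drlMonomials n d).length := by
    exact_mod_cast Matrix.rank_le_width _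
  have hrows := length_macaulayRows_mul_le hF
  refine (hE q _ _ (macaulayMatrix d F)).trans ?_
  set L := (drlMonomials n d).length
  calc c * (macaulayRows d F).length * L * (max (macaulayMatrix d F).rank 1 : ℝ) ^ (ω - 2)
      = c * ((macaulayRows d F).length * L) *
          (max (macaulayMatrix d F).rank 1 : ℝ) ^ (ω - 2) := by ring
    _ ≤ c * (κ * L ^ 3) * (L : ℝ) ^ (ω - 2) := by
        gcongr
        exact max_le hrank hL
    _ = c * κ * ((L : ℝ) ^ (3 : ℝ) * (L : ℝ) ^ (ω - 2)) := by norm_cast; ring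
    _ = c * κ * (L : ℝ) ^ (ω + 1) := by
        rw [← Real.rpow_add (by linarith)]
        ring_nf

theorem length_mul_length_drlMonomials_le (hω : 2 ≤ ω) (hκ : 0 ≤ κ)
    (hF : (F.length : ℝ) ≤ κ * (drlMonomials n d).length) :
    (F.length : ℝ) * (drlMonomials n d).length ≤ κ * (drlMonomials n d).length ^ (ω + 1) := by
  have hL : (1 : ℝ) ≤ (drlMonomials n d).length := by
    exact_mod_cast one_le_length_drlMonomials n d
  have hpow := length_drlMonomials_pow_three_le n d hω
  set L := (drlMonomials n d).length
  calc (F.length : ℝ) * L ≤ κ * L * L := by gcongr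
    _ ≤ κ * L * L * L := le_mul_of_one_le_right (by positivity) hL
    _ = κ * (L : ℝ) ^ 3 := by ring
    _ ≤ κ * (L : ℝ) ^ (ω + 1) := by gcongr

theorem length_macaulayRows_mul_le_rpow (hω : 2 ≤ ω) (hκ : 0 ≤ κ)
    (hF : (F.length : ℝ) ≤ κ * (drlMonomials n d).length) :
    ((macaulayRows d F).length : ℝ) * (drlMonomials n d).length ≤
      κ * (drlMonomials n d).length ^ (ω + 1) :=
  (length_macaulayRows_mul_le hF).trans
    (mul_le_mul_of_nonneg_left (length_drlMonomials_pow_three_le n d hω) hκ)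

theorem HasStepBound.roundTime_le (hE : E.HasStepBound ω c) (hω : 2 ≤ ω) (hc : 0 ≤ c)
    (hκ : 0 ≤ κ) (hF : (F.length : ℝ) ≤ κ * (drlMonomials n d).length) :
    (E.roundTime d F : ℝ) ≤ (3 + c) * κ * (drlMonomials n d).length ^ (ω + 1) := by
  have hsystem := length_mul_length_drlMonomials_le hω hκ hF
  have hmatrix := length_macaulayRows_mul_le_rpow hω hκ hF
  have hsteps := hE.steps_macaulayMatrix_le hω hc hκ hF
  rw [roundTime]
  push_cast
  linarith

theorem HasStepBound.roundSpace_le (hE : E.HasStepBound ω c) (hω : 2 ≤ ω) (hc : 0 ≤ c)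
    (hκ : 0 ≤ κ) (hF : (F.length : ℝ) ≤ κ * (drlMonomials n d).length) :
    (E.roundSpace d F : ℝ) ≤ (3 + 3 * c) * κ * (drlMonomials n d).length ^ (ω + 1) := by
  have hsystem := length_mul_length_drlMonomials_le hω hκ hF
  have hmatrix := length_macaulayRows_mul_le_rpow hω hκ hF
  have hsteps := hE.steps_macaulayMatrix_le hω hc hκ hF
  have hspace : (E.space (macaulayMatrix d F) : ℝ) ≤
      2 * ((macaulayRows d F).length * (drlMonomials n d).length) +
        3 * E.steps (macaulayMatrix d F) := by
    exact_mod_cast E.space_le (macaulayMatrix d F)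
  rw [roundSpace]
  push_cast
  linarith

theorem length_system_le_mul (E : RowReduction) (hκ : 1 ≤ κ)
    (hF : (F.length : ℝ) ≤ κ * (drlMonomials n d).length) (j : ℕ) :
    ((E.system d F j).length : ℝ) ≤ κ * (drlMonomials n d).length := by
  refine (Nat.cast_le.2 (E.length_system_le d F j)).trans ?_
  rw [Nat.cast_max]
  exact max_le hF (le_mul_of_one_le_left (Nat.cast_nonneg _) hκ)

theorem HasStepBound.time_le (hE : E.HasStepBound ω c) (hω : 2 ≤ ω) (hc : 0 ≤ c) (hκ : 1 ≤ κ)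
    (hF : (F.length : ℝ) ≤ κ * (drlMonomials n d).length) :
    (E.time d F : ℝ) ≤ 3 * (3 + c) * κ * (drlMonomials n d).length ^ (ω + 2) := by
  have hround j := hE.roundTime_le hω hc (zero_le_one.trans hκ) (E.length_system_le_mul hκ hF j)
  have hL := one_le_length_drlMonomials n d
  have hrounds : ((E.lastRound d F + 1 : ℕ) : ℝ) ≤ 3 * (drlMonomials n d).length := by
    have := E.lastRound_le d F
    exact_mod_cast (by omega : E.lastRound d F + 1 ≤ 3 * (drlMonomials n d).length)
  rw [time, Nat.cast_sum]
  refine (Finset.sum_le_card_nsmul _ _ _ fun j _ => hround j).trans ?_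
  rw [Finset.card_range, nsmul_eq_mul]
  set L := (drlMonomials n d).length
  calc _ ≤ 3 * L * ((3 + c) * κ * (L : ℝ) ^ (ω + 1)) := by gcongr
    _ = 3 * (3 + c) * κ * ((L : ℝ) ^ (1 : ℝ) * (L : ℝ) ^ (ω + 1)) := by
      rw [Real.rpow_one]
      ring
    _ = 3 * (3 + c) * κ * (L : ℝ) ^ (ω + 2) := by
      rw [← Real.rpow_add (by exact_mod_cast hL)]
      ring_nf

theorem HasStepBound.memory_le (hE : E.HasStepBound ω c) (hω : 2 ≤ ω) (hc : 0 ≤ c) (hκ : 1 ≤ κ)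
    (hF : (F.length : ℝ) ≤ κ * (drlMonomials n d).length) :
    (E.memory d F : ℝ) ≤ (3 + 3 * c) * κ * (drlMonomials n d).length ^ (ω + 1) := by
  have hround j := hE.roundSpace_le hω hc (zero_le_one.trans hκ) (E.length_system_le_mul hκ hF j)
  have hsup : E.memory d F ≤ ⌊(3 + 3 * c) * κ * (drlMonomials n d).length ^ (ω + 1)⌋₊ :=
    Finset.sup_le fun j _ => Nat.le_floor (hround j)
  exact (Nat.cast_le.2 hsup).trans (Nat.floor_le (by positivity))

end RowReduction

theorem choose_le_length_drlMonomials (n : ℕ) {e d : ℕ} (hed : e ≤ d) :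
    (n + e - 1).choose e ≤ (drlMonomials n d).length := by
  rw [length_drlMonomials]
  calc (n + e - 1).choose e ≤ (n + e).choose e := Nat.choose_le_choose _ (Nat.sub_le _ _)
    _ = (e + n).choose n := by rw [← Nat.choose_symm_add, add_comm]
    _ ≤ (d + n).choose n := Nat.choose_le_choose _ (by omega)

theorem cast_le_max_mul_length_drlMonomials {m n e d : ℕ} {K : ℝ} (hed : e ≤ d)
    (hm : (m : ℝ) ≤ K * (n + e - 1).choose e) :
    (m : ℝ) ≤ max K 1 * (drlMonomials n d).length := by
  refine hm.trans ?_
  gcongr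
  · exact le_max_left _ _
  · exact choose_le_length_drlMonomials n hed

namespace RowReduction

variable {E : RowReduction} {ω : ℝ}

theorem HasExponent.exists_time_le (hE : E.HasExponent ω) (hω : 2 ≤ ω) (hω' : ω ≤ 3) (K : ℝ) :
    ∃ C : ℝ, ∀ (q : ℕ) [Fact q.Prime] (n D : ℕ) (F : List (MvPolynomial (Fin n) (ZMod q))),
      2 ≤ n → 0 < D → (F.length : ℝ) ≤ K * (n + D - 1).choose D →
      (E.time (2 * D - 1) F : ℝ) ≤
        C * ((D : ℝ) ^ 3 * 2 ^ ((ω + 3) * growthExponent (2 * D - 1) (n - 1))) := by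
  obtain ⟨c, hc, hstep⟩ := hE.exists_hasStepBound
  have hκ : 1 ≤ max K 1 := le_max_right _ _
  refine ⟨3 * (3 + c) * max K 1 * 32000, fun q _ n D F hn hD hF => ?_⟩
  have hlength := length_drlMonomials_rpow_le hn hD (p := ω + 2) (by linarith) (by linarith)
  rw [add_assoc ω 2 1, two_add_one_eq_three] at hlength
  calc (E.time (2 * D - 1) F : ℝ)
      ≤ 3 * (3 + c) * max K 1 * (drlMonomials n (2 * D - 1)).length ^ (ω + 2) :=
        hstep.time_le hω hc hκ (cast_le_max_mul_length_drlMonomials (by omega) hF)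
    _ ≤ 3 * (3 + c) * max K 1 * _ := by gcongr
    _ = _ := (mul_assoc _ _ _).symm

theorem HasExponent.exists_memory_le (hE : E.HasExponent ω) (hω : 2 ≤ ω) (hω' : ω ≤ 3) (K : ℝ) :
    ∃ C : ℝ, ∀ (q : ℕ) [Fact q.Prime] (n D : ℕ) (F : List (MvPolynomial (Fin n) (ZMod q))),
      2 ≤ n → 0 < D → (F.length : ℝ) ≤ K * (n + D - 1).choose D →
      (E.memory (2 * D - 1) F : ℝ) ≤
        C * ((D : ℝ) ^ 3 * 2 ^ (5 * growthExponent (2 * D - 1) (n - 1))) := by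
  obtain ⟨c, hc, hstep⟩ := hE.exists_hasStepBound
  have hκ : 1 ≤ max K 1 := le_max_right _ _
  refine ⟨(3 + 3 * c) * max K 1 * 32000, fun q _ n D F hn hD hF => ?_⟩
  have hL : (1 : ℝ) ≤ (drlMonomials n (2 * D - 1)).length := by
    exact_mod_cast one_le_length_drlMonomials n _
  have hlength := length_drlMonomials_rpow_le hn hD (p := 4) (by norm_num) (by norm_num)
  rw [show (4 : ℝ) + 1 = 5 by norm_num] at hlength
  calc (E.memory (2 * D - 1) F : ℝ)
      ≤ (3 + 3 * c) * max K 1 * (drlMonomials n (2 * D - 1)).length ^ (ω + 1) :=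
        hstep.memory_le hω hc hκ (cast_le_max_mul_length_drlMonomials (by omega) hF)
    _ ≤ (3 + 3 * c) * max K 1 * (drlMonomials n (2 * D - 1)).length ^ (4 : ℝ) := by
        gcongr
        linarith
    _ ≤ (3 + 3 * c) * max K 1 * _ := by gcongr
    _ = _ := (mul_assoc _ _ _).symm

theorem isGroebnerBasis_output_lweSystem (E : RowReduction) {q n m N : ℕ} [Fact q.Prime]
    {S : Fin m → (Fin n → ZMod q) × ZMod q}
    (hS : HasDegreeOfRegularity {f | f ∈ lweSystem N S} (2 * N + 1)) :
    IsGroebnerBasis (drl n) {g | g ∈ E.output (2 * (2 * N + 1) - 1) (lweSystem N S)}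
      (Ideal.span {f | f ∈ lweSystem N S}) :=
  E.isGroebnerBasis_output (e := 2 * N) (by omega) (by omega)
    (fun _ => totalDegree_le_of_mem_lweSystem) hS.1

end RowReduction

/-! ### Success probability -/

theorem one_sub_le_gaussianError_real {δ : ℝ → ℤ} (hδ : IsDiscretization δ) (σ : ℝ≥0) (N : ℕ) :
    1 - 2 * Real.exp (σ ^ 2 / 2) * Real.exp (-N) ≤ (gaussianError σ δ).real {e | |e| ≤ N} := by
  rw [gaussianError, map_measureReal_apply hδ.1 .of_discrete]
  set γ := gaussianReal 0 (σ ^ 2)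
  have hright : γ.real {x : ℝ | (N : ℝ) ≤ x} ≤ Real.exp (-N) * Real.exp (σ ^ 2 / 2) := by
    simpa [mgf_id_gaussianReal, γ] using measure_ge_le_exp_mul_mgf (μ := γ) (X := id) (t := 1) N
      zero_le_one (integrable_exp_mul_gaussianReal 1)
  have hleft : γ.real {x : ℝ | x ≤ -(N : ℝ)} ≤ Real.exp (-N) * Real.exp (σ ^ 2 / 2) := by
    simpa [mgf_id_gaussianReal, γ] using measure_le_le_exp_mul_mgf (μ := γ) (X := id) (t := -1)
      (-N) (by norm_num) (integrable_exp_mul_gaussianReal (-1))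
  have htails : (δ ⁻¹' {e | |e| ≤ N})ᶜ ⊆ {x : ℝ | (N : ℝ) ≤ x} ∪ {x : ℝ | x ≤ -(N : ℝ)} := by
    intro x hx
    by_contra hcon
    simp only [Set.mem_union, Set.mem_ofPred_eq, not_or, not_le] at hcon
    exact hx (hδ.2 x N (abs_le.2 ⟨hcon.2.le, hcon.1.le⟩))
  have hunion := (measureReal_mono htails (measure_ne_top γ _)).trans (measureReal_union_le _ _)
  rw [probReal_compl_eq_one_sub (hδ.1 .of_discrete)] at hunion
  linarith

theorem measureReal_pi_prod_fst_inter_snd {ι α β : Type*} [Fintype ι] [MeasurableSpace α]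
    [MeasurableSpace β] (ν : Measure α) (χ : Measure β) [SigmaFinite ν] [SigmaFinite χ]
    (R : Set (ι → α)) (T : Set (ι → β)) :
    (Measure.pi fun _ : ι => ν.prod χ).real
        ({w | (fun i => (w i).1) ∈ R} ∩ {w | (fun i => (w i).2) ∈ T}) =
      (Measure.pi fun _ => ν).real R * (Measure.pi fun _ => χ).real T := by
  rw [← measureReal_prod_prod,
    ← (measurePreserving_arrowProdEquivProdArrow α β ι (fun _ => ν) fun _ => χ).map_eq,
    measureReal_def, measureReal_def, MeasurableEquiv.map_apply]
  rfl

theorem le_cond_measureReal {Ω : Type*} [MeasurableSpace Ω] {μ : Measure Ω} [IsFiniteMeasure μ]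
    {A A' B S : Set Ω} (hA : MeasurableSet A) (hA0 : μ A ≠ 0) (hAA' : A ⊆ A')
    (hA'B : A' ∩ B ⊆ A ∩ S) (hindep : μ.real (A' ∩ B) = μ.real A' * μ.real B) :
    μ.real B ≤ μ[|A].real S := by
  have hApos : 0 < μ.real A := ENNReal.toReal_pos hA0 (measure_ne_top _ _)
  rw [measureReal_def μ[|A], cond_apply hA, ENNReal.toReal_mul, ENNReal.toReal_inv,
    ← measureReal_def, ← measureReal_def, inv_mul_eq_div, le_div_iff₀ hApos]
  calc μ.real B * μ.real A ≤ μ.real B * μ.real A' :=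
        mul_le_mul_of_nonneg_left (measureReal_mono hAA') measureReal_nonneg
    _ = μ.real (A' ∩ B) := by rw [hindep, mul_comm]
    _ ≤ μ.real (A ∩ S) := measureReal_mono hA'B

section LWE

variable {q n m N D d : ℕ} [Fact q.Prime] {s : Fin n → ZMod q}
  {w : Fin m → (Fin n → ZMod q) × ℤ} {χ : Measure ℤ} [IsProbabilityMeasure χ]

theorem RowReduction.mem_lweSuccess (E : RowReduction) (hw : ∀ i, |(w i).2| ≤ N) :
    w ∈ lweSuccess E m N d s :=
  ⟨hw, fun g hg => E.mem_ideal_of_mem_system (I := RingHom.ker (MvPolynomial.eval s))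
    (fun _ hf => eval_eq_zero_of_mem_lweSystem hw hf) _ g hg⟩

theorem lweErrorPoly_eval_lweSample (hw : ∀ i, |(w i).2| ≤ N) (i : Fin m)
    (hi : (lweSample s (w i)).1 = 0) : (lweErrorPoly q N).eval (lweSample s (w i)).2 = 0 := by
  have hfst : (w i).1 = 0 := hi
  simpa [lweSample, hfst] using eval_lweErrorPoly (q := q) (hw i)

theorem mem_lweRegular_iff_of_abs_le (hw : ∀ i, |(w i).2| ≤ N) :
    w ∈ lweRegular m N D s ↔
      HasDegreeOfRegularity {f | f ∈ lweSystem N fun i => ((w i).1, 0)} D :=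
  hasDegreeOfRegularity_lweSystem_iff (lweErrorPoly_eval_lweSample hw)

theorem hasDegreeOfRegularity_of_mem_lweRegular (hD : 0 < D) (hw : w ∈ lweRegular m N D s) :
    HasDegreeOfRegularity {f | f ∈ lweSystem N fun i => ((w i).1, 0)} D :=
  (hasDegreeOfRegularity_lweSystem_iff fun _ =>
    eval_eq_zero_of_hasDegreeOfRegularity hD hw).1 hw

instance : IsProbabilityMeasure (uniformOn (Set.univ : Set (Fin n → ZMod q))) :=
  isProbabilityMeasure_uniformOn Set.finite_univ Set.univ_nonempty

instance : IsProbabilityMeasure (lweChoices q n m χ) := by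
  unfold lweChoices
  infer_instance

theorem lweChoices_real_inter (R : Set (Fin m → Fin n → ZMod q)) (T : Set (Fin m → ℤ)) :
    (lweChoices q n m χ).real ({w | (fun i => (w i).1) ∈ R} ∩ {w | (fun i => (w i).2) ∈ T}) =
      (lweChoices q n m χ).real {w | (fun i => (w i).1) ∈ R} *
        (lweChoices q n m χ).real {w | (fun i => (w i).2) ∈ T} := by
  have hR := measureReal_pi_prod_fst_inter_snd (uniformOn (Set.univ : Set (Fin n → ZMod q))) χ
    R Set.univ
  have hT := measureReal_pi_prod_fst_inter_snd (uniformOn (Set.univ : Set (Fin n → ZMod q))) χ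
    Set.univ T
  simp only [Set.mem_univ, Set.ofPred_true, Set.inter_univ, Set.univ_inter, probReal_univ, mul_one,
    one_mul] at hR hT
  rw [lweChoices, measureReal_pi_prod_fst_inter_snd, hR, hT]

theorem lweChoices_real_forall_abs_le (N : ℕ) :
    (lweChoices q n m χ).real {w | ∀ i, |(w i).2| ≤ N} = χ.real {e | |e| ≤ N} ^ m := by
  have hpi : {w : Fin m → (Fin n → ZMod q) × ℤ | ∀ i, |(w i).2| ≤ N} =
      Set.univ.pi fun _ => Set.univ ×ˢ {e : ℤ | |e| ≤ N} := by
    ext w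
    simp
  rw [hpi, lweChoices, measureReal_def, Measure.pi_pi, ENNReal.toReal_prod, Finset.prod_const,
    Finset.card_univ, Fintype.card_fin, ← measureReal_def, measureReal_prod_prod, probReal_univ,
    one_mul]

theorem pow_le_lweChoices_real_lweSuccess (E : RowReduction) :
    χ.real {e | |e| ≤ N} ^ m ≤ (lweChoices q n m χ).real (lweSuccess E m N d s) := by
  rw [← lweChoices_real_forall_abs_le (q := q) (n := n)]
  exact measureReal_mono fun _ => E.mem_lweSuccess

/- The degree of regularity may depend on the errors, but only through the samples with `aᵢ = 0`.
If all errors are small, or if `d_reg > 0`, it is that of the noise-free samples `(aᵢ, 0)`, which is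
independent of the errors. -/
theorem pow_le_cond_lweRegular_real_lweSuccess (E : RowReduction) (hD : 0 < D)
    (h0 : lweChoices q n m χ (lweRegular m N D s) ≠ 0) :
    χ.real {e | |e| ≤ N} ^ m ≤
      ((lweChoices q n m χ)[|lweRegular m N D s]).real (lweSuccess E m N d s) := by
  rw [← lweChoices_real_forall_abs_le (q := q) (n := n)]
  exact le_cond_measureReal .of_discrete h0
    (fun _ => hasDegreeOfRegularity_of_mem_lweRegular hD)
    (fun _ hw => ⟨(mem_lweRegular_iff_of_abs_le hw.2).2 hw.1, E.mem_lweSuccess hw.2⟩)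
    (lweChoices_real_inter
      {a | HasDegreeOfRegularity {f | f ∈ lweSystem N fun i => (a i, 0)} D}
      {e | ∀ i, |e i| ≤ N})

end LWE

theorem choose_le_three_mul_pow {n N : ℕ} (hn : 0 < n) (hnN : n ≤ N) :
    (n + (2 * N + 1) - 1).choose (2 * N + 1) ≤ (3 * N) ^ (n - 1) := by
  rw [Nat.choose_symm_of_eq_add (show n + (2 * N + 1) - 1 = 2 * N + 1 + (n - 1) by omega)]
  exact (Nat.choose_le_pow _ _).trans (Nat.pow_le_pow_left (by omega) _)

theorem IsDiscretization.isProbabilityMeasure_gaussianError {δ : ℝ → ℤ} (hδ : IsDiscretization δ)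
    (σ : ℝ≥0) : IsProbabilityMeasure (gaussianError σ δ) :=
  Measure.isProbabilityMeasure_map hδ.1.aemeasurable

theorem one_sub_mul_le_gaussianError_real_pow {δ : ℝ → ℤ} (hδ : IsDiscretization δ) (σ : ℝ≥0)
    (N m : ℕ) :
    1 - m * (2 * Real.exp (σ ^ 2 / 2) * Real.exp (-N)) ≤
      (gaussianError σ δ).real {e | |e| ≤ N} ^ m := by
  set p := (gaussianError σ δ).real {e | |e| ≤ N}
  have hp : 0 ≤ p := measureReal_nonneg
  calc 1 - m * (2 * Real.exp (σ ^ 2 / 2) * Real.exp (-N)) ≤ 1 + m * (p - 1) := by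
        have := mul_le_mul_of_nonneg_left (one_sub_le_gaussianError_real hδ σ N)
          (Nat.cast_nonneg (α := ℝ) m)
        linarith
    _ ≤ p ^ m := one_add_mul_sub_le_pow (by linarith) m

theorem eventually_one_sub_le_gaussianError_real_pow {n : ℕ} (hn : 0 < n) (σ : ℝ≥0) (K : ℝ)
    {ε : ℝ} (hε : 0 < ε) :
    ∀ᶠ N : ℕ in Filter.atTop, ∀ m : ℕ, (m : ℝ) ≤ K * (n + (2 * N + 1) - 1).choose (2 * N + 1) →
      ∀ δ, IsDiscretization δ → 1 - ε ≤ (gaussianError σ δ).real {e | |e| ≤ N} ^ m := by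
  set c := |K| * 3 ^ (n - 1) * (2 * Real.exp (σ ^ 2 / 2)) with hc
  have hlim : Filter.Tendsto (fun N : ℕ => c * ((N : ℝ) ^ (n - 1) * Real.exp (-N))) Filter.atTop
      (nhds 0) := by
    simpa [Function.comp_def] using
      ((Real.tendsto_pow_mul_exp_neg_atTop_nhds_zero (n - 1)).const_mul c).comp
        tendsto_natCast_atTop_atTop
  filter_upwards [hlim.eventually_le_const hε, Filter.eventually_ge_atTop n] with N hN hnN
  intro m hm δ hδ
  have hmK : (m : ℝ) ≤ |K| * (3 * N) ^ (n - 1) := by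
    refine hm.trans ?_
    gcongr
    · exact le_abs_self K
    · exact_mod_cast choose_le_three_mul_pow hn hnN
  have htail : m * (2 * Real.exp (σ ^ 2 / 2) * Real.exp (-N)) ≤ ε := by
    calc m * (2 * Real.exp (σ ^ 2 / 2) * Real.exp (-N))
        ≤ |K| * (3 * N) ^ (n - 1) * (2 * Real.exp (σ ^ 2 / 2) * Real.exp (-N)) := by gcongr
      _ = c * ((N : ℝ) ^ (n - 1) * Real.exp (-N)) := by
        rw [hc, mul_pow]
        ring
      _ ≤ ε := hN
  linarith [one_sub_mul_le_gaussianError_real_pow hδ σ N m]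

theorem mainTheorem8 (ω : ℝ) (hω : 2 ≤ ω) (hω' : ω ≤ 3)
    (E : RowReduction) (hE : E.HasExponent ω) (K : ℝ) :
    -- complexity, with `N = tσ`: `C` depends only on `ω`, `E` and the constant `K` in `m = O(·)`
    (∃ C : ℝ, ∀ (q : ℕ) [Fact q.Prime] (n m N D : ℕ), 2 ≤ n → D = 2 * N + 1 →
      (m : ℝ) ≤ K * (n + D - 1).choose D →
      ∀ S : Fin m → (Fin n → ZMod q) × ZMod q,
        HasDegreeOfRegularity {f | f ∈ lweSystem N S} D →
        E.Terminates (2 * D - 1) (lweSystem N S) ∧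
        IsGroebnerBasis (drl n) {g | g ∈ E.output (2 * D - 1) (lweSystem N S)}
          (Ideal.span {f | f ∈ lweSystem N S}) ∧
        (E.time (2 * D - 1) (lweSystem N S) : ℝ) ≤
          C * ((D : ℝ) ^ 3 * (2 : ℝ) ^ ((ω + 3) * (2 : ℝ) ^ (1 / Real.log 2) *
            (2 * D - 1 : ℝ) ^ (1 / Real.log 4) * (n - 1 : ℝ) ^ (1 - 1 / Real.log 4))) ∧
        (E.memory (2 * D - 1) (lweSystem N S) : ℝ) ≤
          C * ((D : ℝ) ^ 3 * (2 : ℝ) ^ (5 * (2 : ℝ) ^ (1 / Real.log 2) *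
            (2 * D - 1 : ℝ) ^ (1 / Real.log 4) * (n - 1 : ℝ) ^ (1 - 1 / Real.log 4)))) ∧
    -- success probability, for `t → ∞`, over all samples and given that `d_reg = D`
    (∀ (n : ℕ) (σ : ℝ≥0) (ε : ℝ), 2 ≤ n → 0 < σ → 0 < ε → ∃ t₀ : ℝ, ∀ t : ℝ, t₀ ≤ t →
      ∀ (q : ℕ) [Fact q.Prime] (m N D : ℕ), t * σ = N → D = 2 * N + 1 →
      (m : ℝ) ≤ K * (n + D - 1).choose D →
      ∀ (s : Fin n → ZMod q) (δ : ℝ → ℤ), IsDiscretization δ →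
        1 - ε ≤ (lweChoices q n m (gaussianError σ δ)).real (lweSuccess E m N (2 * D - 1) s) ∧
        (lweChoices q n m (gaussianError σ δ) (lweRegular m N D s) ≠ 0 →
          1 - ε ≤ ((lweChoices q n m (gaussianError σ δ))[|lweRegular m N D s]).real
            (lweSuccess E m N (2 * D - 1) s))) := by
  obtain ⟨C₁, hC₁⟩ := hE.exists_time_le hω hω' K
  obtain ⟨C₂, hC₂⟩ := hE.exists_memory_le hω hω' K
  simp only [← mul_growthExponent]
  refine ⟨⟨max C₁ C₂, fun q _ n m N D hn hD hm S hS => ?_⟩, fun n σ ε hn hσ hε => ?_⟩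
  · subst hD
    rw [← length_lweSystem N S] at hm
    refine ⟨E.terminates _ _, E.isGroebnerBasis_output_lweSystem hS,
      (hC₁ q n _ _ hn (by omega) hm).trans ?_, (hC₂ q n _ _ hn (by omega) hm).trans ?_⟩
    · gcongr
      exact le_max_left C₁ C₂
    · gcongr
      exact le_max_right C₁ C₂
  · obtain ⟨N₀, hN₀⟩ := Filter.eventually_atTop.1 <|
      eventually_one_sub_le_gaussianError_real_pow (by omega : 0 < n) σ K hε
    refine ⟨N₀ / σ, fun t ht q _ m N D hN hD hm s δ hδ => ?_⟩
    subst hD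
    rw [div_le_iff₀ (NNReal.coe_pos.2 hσ), hN, Nat.cast_le] at ht
    have := hδ.isProbabilityMeasure_gaussianError σ
    have hsmall := hN₀ N ht m hm δ hδ
    exact ⟨hsmall.trans (pow_le_lweChoices_real_lweSuccess E),
      fun h0 => hsmall.trans (pow_le_cond_lweRegular_real_lweSuccess E (by omega) h0)⟩
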